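/- Let $n\ge 1$ be an integer, and for $1\le p\le q<\infty$ and measurable $f:\mathbb{R}^n\to\mathbb{C}$ put \[ \|f\|_{\mathcal{M}^p_q}:=\sup_{a\in\mathbb{R}^n,\ r>0}|B(a,r)|^{\frac1q-\frac1p}\left(\int_{B(a,r)}|f(y)|^p\,dy\right)^{\frac1p}\in[0,\infty]; \] the Morrey space $\mathcal{M}^p_q(\mathbb{R}^n)$ consists of those $f$ for which this is finite. For $\alpha>0$ and $g\in C_c^\infty(\mathbb{R}^n)$ (complex-valued) let $(-\Delta)^{\alpha/2}g$ be the function whose Fourier transform is $|\xi|^\alpha\widehat g(\xi)$, that is, \[ (-\Delta)^{\alpha/2}g(x)=(2\pi)^{-n}\int_{\mathbb{R}^n}e^{ix\cdot\xi}|\xi|^\alpha\,\widehat g(\xi)\,d\xi,\qquad \widehat g(\xi)=\int_{\mathbb{R}^n}g(x)e^{-ix\cdot\xi}\,dx . \] Let $1<p\le q<\infty$ and $0<\alpha<\frac nq$. Then there is a constant $C$, depending only on $n,p,q,\alpha$, such that for every $g\in C_c^\infty(\mathbb{R}^n)$ the functions $(-\Delta)^{\alpha/2}g$ and $|\cdot|^{-\alpha}g$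 belong to $\mathcal{M}^p_q(\mathbb{R}^n)$ and \[ \big\||\cdot|^{-\alpha}g\big\|_{\mathcal{M}^p_q}\le C\,\big\|(-\Delta)^{\alpha/2}g\big\|_{\mathcal{M}^p_q}. \] -/

import Mathlib

open MeasureTheory
open scoped ENNReal NNReal FourierTransform ContDiff

noncomputable section

/-- The Morrey norm, as an element of `[0, ∞]`:
`sup_{a, r > 0} |B(a,r)|^{1/q - 1/p} (∫_{B(a,r)} |f|^p)^{1/p}`. -/
def morreyNorm {n : ℕ} (p q : ℝ) (f : EuclideanSpace ℝ (Fin n) → ℂ) : ℝ≥0∞ :=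
  ⨆ (a : EuclideanSpace ℝ (Fin n)) (r : ℝ) (_ : 0 < r),
    volume (Metric.ball a r) ^ (1 / q - 1 / p) *
      (∫⁻ y in Metric.ball a r, ‖f y‖ₑ ^ p) ^ (1 / p)

/-- Membership in the Morrey space: measurable with finite Morrey norm.
(Finiteness of the norm makes `|f|^p` integrable on every ball, so `f` is locally in `L^p`.) -/
def MemMorrey {n : ℕ} (p q : ℝ) (f : EuclideanSpace ℝ (Fin n) → ℂ) : Prop :=
  AEStronglyMeasurable f volume ∧ morreyNorm p q f < ⊤

/-- The fractional power `(-Δ)^{α/2} g`. With `ĝ(ξ) = ∫ g(x) e^{-i x·ξ} dx` it is the function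
with Fourier transform `|ξ|^α ĝ(ξ)`, that is
`(-Δ)^{α/2} g (x) = (2π)^{-n} ∫ e^{i x·ξ} |ξ|^α ĝ(ξ) dξ`.
Mathlib's `𝓕` has the kernel `e^{-2πi x·ξ}`, so `ĝ(2πξ) = 𝓕 g ξ`, and the substitution
`ξ ↦ 2πξ` turns the formula into the one below. -/
def fracLaplacian {n : ℕ} (α : ℝ) (g : EuclideanSpace ℝ (Fin n) → ℂ) :
    EuclideanSpace ℝ (Fin n) → ℂ :=
  𝓕⁻ (fun ξ : EuclideanSpace ℝ (Fin n) => (((2 * Real.pi * ‖ξ‖) ^ α : ℝ) : ℂ) * 𝓕 g ξ)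

end

/-!
Write `f = (-Δ)^{α/2} g`, `d = n` and `s = n / q`, so that `α < s ≤ n / p`. The inequality follows
from two facts.

* *Representation.* `|g| ≤ C I_α |f|`, where `I_α F (x) = ∫ |x - y|^{α-d} F(y) dy`
  (`exists_enorm_le_riesz_potential`). For a smooth compactly supported radial bump `χ`, the
  multiplier `|ξ|^{-α}` is a superposition `c ∫₀^∞ χ(s|ξ|) s^{α-1} ds`
  (`exists_enorm_fourierInv_le`), and the multiplier `χ(s|ξ|)` averages the translates
  `f(x - s y)` against a Schwartz function. Summing the averages gives the Riesz kernel
  (`exists_lintegral_dilates_le`).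

* *Weighted bound.* `F ↦ |·|^{-α} I_α F` is bounded on the Morrey space
  (`exists_morrey_weighted_riesz_le`). Split the potential at distance `R` from `x`. The far part
  is at most `R^{α-s}` times the Morrey norm, by a dyadic decomposition; this is where `α < n/q`
  enters. For a ball `B(a, r)` with `2r ≤ |a|`, take `R = |a|`: the weight is comparable to
  `|a|^{-α}` and the near part is convolution with a kernel of mass `|a|^α`. For `|a| < 2r`, take
  `R = 3r`: the near part only sees `F` on `B(0, 6r)`, and there the Stein–Weiss inequality on
  `L^p` applies. It is proved by Schur's test with a power weight.

That `f` has finite Morrey norm follows from `f ∈ L¹ ∩ L^∞ ⊆ L^q`. Boundedness is clear from the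
integrability of `|ξ|^α ĝ`; for `f ∈ L¹` the multiplier `|ξ|^α` is written as a superposition of
dilates of `|ξ|^{2m} χ(|ξ|)` with `2m > α` (`lintegral_enorm_fourierInv_rpow_mul_lt_top`).

The estimates are stated for `[0, ∞]`-valued functions, with `d` a real number equal to the
dimension. Powers are those of `[0, ∞]`, so that a kernel is `⊤` on the diagonal.
-/

/-! ### Powers and dyadic decomposition -/

theorem ofReal_rpow_mul_rpow {r : ℝ} (hr : 0 < r) (a b : ℝ) :
    ENNReal.ofReal r ^ a * ENNReal.ofReal r ^ b = ENNReal.ofReal r ^ (a + b) :=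
  (ENNReal.rpow_add a b (by simpa using hr) ENNReal.ofReal_ne_top).symm

theorem rpow_ne_top_of_ne {x : ℝ≥0∞} (h0 : x ≠ 0) (ht : x ≠ ⊤) (a : ℝ) : x ^ a ≠ ⊤ := by
  simp [ENNReal.rpow_eq_top_iff, h0, ht]

theorem ofReal_rpow_ne_top {r : ℝ} (hr : 0 < r) (a : ℝ) : ENNReal.ofReal r ^ a ≠ ⊤ :=
  rpow_ne_top_of_ne (by simpa using hr) ENNReal.ofReal_ne_top a

theorem rpow_anti_of_nonpos {x y : ℝ≥0∞} (h : x ≤ y) {b : ℝ} (hb : b ≤ 0) : y ^ b ≤ x ^ b := by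
  have := ENNReal.rpow_le_rpow h (neg_nonneg.2 hb)
  rw [← neg_neg b, ENNReal.rpow_neg, ENNReal.rpow_neg x]
  exact ENNReal.inv_le_inv.2 this

theorem le_enorm_sub_of_notMem_ball {E : Type*} [NormedAddCommGroup E] {x y : E} {r : ℝ}
    (h : y ∉ Metric.ball x r) : ENNReal.ofReal r ≤ ‖x - y‖ₑ := by
  rw [← ofReal_norm]
  apply ENNReal.ofReal_le_ofReal
  simpa [dist_eq_norm, norm_sub_rev] using h

section Dyadic

variable {E : Type*} [NormedAddCommGroup E] [MeasurableSpace E] [BorelSpace E]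

/-- The building block of all kernel estimates: a set covered by the annuli
`R tᵏ ≤ |x - y| < 4 R tᵏ`, `k ∈ ℕ`, and a measure of growth `κ` on balls centred at `x`. -/
theorem lintegral_dyadic_le {μ : Measure E} {x : E} {A : ℝ≥0∞} {κ β : ℝ} (hβ : 0 ≤ β)
    (hμ : ∀ r : ℝ, 0 < r → μ (Metric.ball x r) ≤ A * ENNReal.ofReal r ^ κ)
    {R t : ℝ} (hR : 0 < R) (ht : 0 < t) {s : Set E}
    (hs : s ⊆ ⋃ k : ℕ, Metric.ball x (4 * (R * t ^ k)) \ Metric.ball x (R * t ^ k)) :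
    ∫⁻ y in s, ‖x - y‖ₑ ^ (-β) ∂μ ≤
      4 ^ κ * (1 - ENNReal.ofReal t ^ (κ - β))⁻¹ * A * ENNReal.ofReal R ^ (κ - β) := by
  have hRk : ∀ k : ℕ, 0 < R * t ^ k := fun k ↦ by positivity
  have key : ∀ k : ℕ, ∫⁻ y in Metric.ball x (4 * (R * t ^ k)) \ Metric.ball x (R * t ^ k),
      ‖x - y‖ₑ ^ (-β) ∂μ ≤
        (4 ^ κ * A * ENNReal.ofReal R ^ (κ - β)) * (ENNReal.ofReal t ^ (κ - β)) ^ k := by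
    intro k
    calc _ ≤ ∫⁻ y in Metric.ball x (4 * (R * t ^ k)) \ Metric.ball x (R * t ^ k),
          ENNReal.ofReal (R * t ^ k) ^ (-β) ∂μ := by
          refine setLIntegral_mono' (measurableSet_ball.diff measurableSet_ball) fun y hy ↦ ?_
          exact rpow_anti_of_nonpos (le_enorm_sub_of_notMem_ball hy.2) (by linarith)
      _ ≤ ENNReal.ofReal (R * t ^ k) ^ (-β) * μ (Metric.ball x (4 * (R * t ^ k))) := by
          rw [setLIntegral_const]
          gcongr
          exact Set.sdiff_subset
      _ ≤ ENNReal.ofReal (R * t ^ k) ^ (-β) *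
            (A * ENNReal.ofReal (4 * (R * t ^ k)) ^ κ) := by
          gcongr
          exact hμ _ (by have := hRk k; positivity)
      _ = 4 ^ κ * A * ENNReal.ofReal (R * t ^ k) ^ (κ - β) := by
          rw [ENNReal.ofReal_mul (p := 4) (by norm_num),
            ENNReal.mul_rpow_of_ne_top (x := ENNReal.ofReal 4) (by simp) (by simp),
            show κ - β = -β + κ by ring, ← ofReal_rpow_mul_rpow (hRk k)]
          simp only [ENNReal.ofReal_ofNat]
          ring
      _ = _ := by
          rw [ENNReal.ofReal_mul hR.le, ENNReal.mul_rpow_of_ne_top (by simp) (by simp),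
            ENNReal.ofReal_pow ht.le, ← ENNReal.rpow_natCast, ← ENNReal.rpow_natCast,
            ← ENNReal.rpow_mul, ← ENNReal.rpow_mul, mul_comm (k : ℝ)]
          ring
  calc _ ≤ ∫⁻ y in ⋃ k : ℕ, Metric.ball x (4 * (R * t ^ k)) \ Metric.ball x (R * t ^ k),
          ‖x - y‖ₑ ^ (-β) ∂μ := lintegral_mono_set hs
    _ ≤ ∑' k : ℕ, ∫⁻ y in Metric.ball x (4 * (R * t ^ k)) \ Metric.ball x (R * t ^ k),
          ‖x - y‖ₑ ^ (-β) ∂μ := lintegral_iUnion_le _ _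
    _ ≤ ∑' k : ℕ, (4 ^ κ * A * ENNReal.ofReal R ^ (κ - β)) *
          (ENNReal.ofReal t ^ (κ - β)) ^ k := ENNReal.tsum_le_tsum key
    _ = _ := by
      rw [ENNReal.tsum_mul_left, ENNReal.tsum_geometric]
      ring

/-- Integral of a power of the distance over the exterior of a ball, for a measure of growth `κ`
less than the exponent. The constant does not depend on the measure. -/
theorem exists_lintegral_compl_ball_le {κ β : ℝ} (hκ : κ < β) (hβ : 0 ≤ β) :
    ∃ C : ℝ≥0∞, C ≠ ⊤ ∧ ∀ (μ : Measure E) (x : E) (A : ℝ≥0∞),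
      (∀ r : ℝ, 0 < r → μ (Metric.ball x r) ≤ A * ENNReal.ofReal r ^ κ) →
      ∀ r : ℝ, 0 < r → ∫⁻ y in (Metric.ball x r)ᶜ, ‖x - y‖ₑ ^ (-β) ∂μ ≤
        C * A * ENNReal.ofReal r ^ (κ - β) := by
  refine ⟨4 ^ κ * (1 - ENNReal.ofReal 2 ^ (κ - β))⁻¹, ?_, fun μ x A hμ r hr ↦
    lintegral_dyadic_le hβ hμ hr two_pos fun y hy ↦ ?_⟩
  · refine ENNReal.mul_ne_top (rpow_ne_top_of_ne (by simp) (by simp) _) ?_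
    rw [ENNReal.inv_ne_top, ← pos_iff_ne_zero, tsub_pos_iff_lt]
    exact ENNReal.rpow_lt_one_of_one_lt_of_neg (by simp) (by linarith)
  · have h1 : r ≤ dist y x := by simpa using hy
    obtain ⟨k, hk, hk'⟩ := exists_nat_pow_near ((one_le_div hr).2 h1) (one_lt_two : (1 : ℝ) < 2)
    rw [le_div_iff₀ hr] at hk
    rw [div_lt_iff₀ hr, pow_succ] at hk'
    refine Set.mem_iUnion.2 ⟨k, ?_, ?_⟩
    · rw [Metric.mem_ball]; nlinarith [pow_pos (two_pos : (0 : ℝ) < 2) k]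
    · rw [Metric.mem_ball]; linarith

/-- Integral of a power of the distance over a ball, for a measure of growth `κ` greater than the
exponent. -/
theorem exists_lintegral_ball_le {κ β : ℝ} (hκ : β < κ) (hβ : 0 ≤ β) :
    ∃ C : ℝ≥0∞, C ≠ ⊤ ∧ ∀ (μ : Measure E) [NullSingletonClass μ] (x : E) (A : ℝ≥0∞),
      (∀ r : ℝ, 0 < r → μ (Metric.ball x r) ≤ A * ENNReal.ofReal r ^ κ) →
      ∀ r : ℝ, 0 < r → ∫⁻ y in Metric.ball x r, ‖x - y‖ₑ ^ (-β) ∂μ ≤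
        C * A * ENNReal.ofReal r ^ (κ - β) := by
  refine ⟨4 ^ κ * (1 - ENNReal.ofReal (1 / 2) ^ (κ - β))⁻¹ * ENNReal.ofReal (1 / 2) ^ (κ - β),
    ?_, fun μ _ x A hμ r hr ↦ ?_⟩
  · refine ENNReal.mul_ne_top (ENNReal.mul_ne_top (rpow_ne_top_of_ne (by simp) (by simp) _) ?_)
      (ofReal_rpow_ne_top (by norm_num) _)
    rw [ENNReal.inv_ne_top, ← pos_iff_ne_zero, tsub_pos_iff_lt]
    refine ENNReal.rpow_lt_one ?_ (by linarith)
    rw [ENNReal.ofReal_lt_one]; norm_num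
  · have h0 : (Metric.ball x r : Set E) =ᵐ[μ] (Metric.ball x r \ {x} : Set E) :=
      (sdiff_null_ae_eq_self (measure_singleton x)).symm
    rw [setLIntegral_congr h0]
    refine (lintegral_dyadic_le hβ hμ (R := r * (1 / 2)) (t := 1 / 2) (by positivity)
      (by norm_num) fun y hy ↦ ?_).trans_eq ?_
    · have h1 : dist y x < r := by simpa using hy.1
      have h2 : 0 < dist y x := dist_pos.2 (by simpa using hy.2)
      obtain ⟨k, hk, hk'⟩ := exists_nat_pow_near ((one_le_div h2).2 h1.le)
        (one_lt_two : (1 : ℝ) < 2)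
      rw [le_div_iff₀ h2] at hk
      rw [div_lt_iff₀ h2, pow_succ] at hk'
      have h2k : (0 : ℝ) < 2 ^ k := by positivity
      have e : r * (1 / 2) * (1 / 2) ^ k = r / 2 / 2 ^ k := by
        rw [one_div_pow]; ring
      refine Set.mem_iUnion.2 ⟨k, ?_, ?_⟩
      · rw [Metric.mem_ball, e, mul_div_assoc', lt_div_iff₀ h2k]; linarith
      · rw [Metric.mem_ball, e, not_lt, div_le_iff₀ h2k]; linarith
    · rw [ENNReal.ofReal_mul hr.le, ENNReal.mul_rpow_of_ne_top (by simp) (by simp)]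
      ring

end Dyadic

/-! ### Riesz kernels and the Stein–Weiss inequality -/

/-- Hölder's inequality with exponents `p/(p-1)` and `p`, raised to the power `p`. -/
theorem rpow_lintegral_mul_le {X : Type*} [MeasurableSpace X] {μ : Measure X} {p : ℝ}
    (hp : 1 < p) {u v : X → ℝ≥0∞} (hu : AEMeasurable u μ) (hv : AEMeasurable v μ) :
    (∫⁻ x, u x ^ ((p - 1) / p) * v x ^ (1 / p) ∂μ) ^ p ≤
      (∫⁻ x, u x ∂μ) ^ (p - 1) * ∫⁻ x, v x ∂μ := by
  have hp0 : 0 < p := by linarith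
  calc _ ≤ ((∫⁻ x, u x ∂μ) ^ ((p - 1) / p) * (∫⁻ x, v x ∂μ) ^ (1 / p)) ^ p := by
        gcongr
        exact ENNReal.lintegral_mul_norm_pow_le hu hv (div_nonneg (by linarith) hp0.le)
          (by positivity) (by field_simp; ring)
    _ = _ := by
        rw [ENNReal.mul_rpow_of_nonneg _ _ hp0.le, ← ENNReal.rpow_mul, ← ENNReal.rpow_mul,
          div_mul_cancel₀ _ hp0.ne', div_mul_cancel₀ _ hp0.ne', ENNReal.rpow_one]

/-- Jensen's inequality for integration against a kernel that need not have mass one. -/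
theorem rpow_lintegral_kernel_mul_le {X : Type*} [MeasurableSpace X] {μ : Measure X} {p : ℝ}
    (hp : 1 < p) {k F : X → ℝ≥0∞} (hk : AEMeasurable k μ) (hF : AEMeasurable F μ) :
    (∫⁻ x, k x * F x ∂μ) ^ p ≤ (∫⁻ x, k x ∂μ) ^ (p - 1) * ∫⁻ x, k x * F x ^ p ∂μ := by
  have hp0 : 0 < p := by linarith
  refine le_trans (le_of_eq ?_) (rpow_lintegral_mul_le hp hk (hk.mul (hF.pow_const p)))
  congr 2 with x
  rw [ENNReal.mul_rpow_of_nonneg _ _ (by positivity), ← mul_assoc,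
    ← ENNReal.rpow_add_of_nonneg _ _ (div_nonneg (by linarith) hp0.le) (by positivity),
    ← ENNReal.rpow_mul, mul_one_div_cancel hp0.ne', ← add_div, sub_add_cancel, div_self hp0.ne',
    ENNReal.rpow_one, ENNReal.rpow_one]

section Kernel

variable {E : Type*} [NormedAddCommGroup E] [InnerProductSpace ℝ E] [FiniteDimensional ℝ E]
  [MeasurableSpace E] [BorelSpace E] {d : ℝ}

theorem volume_unit_ball_ne_top : volume (Metric.ball (0 : E) 1) ≠ ⊤ :=
  measure_ball_lt_top.ne

variable [Nontrivial E]

theorem volume_ball_eq_rpow (hd : (Module.finrank ℝ E : ℝ) = d) (x : E) {r : ℝ} (hr : 0 < r) :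
    volume (Metric.ball x r) = volume (Metric.ball (0 : E) 1) * ENNReal.ofReal r ^ d := by
  rw [Measure.addHaar_ball _ _ hr.le, ← hd, ENNReal.rpow_natCast, ENNReal.ofReal_pow hr.le,
    mul_comm]

theorem exists_lintegral_ball_rpow_le (hd : (Module.finrank ℝ E : ℝ) = d) {β : ℝ} (hβ : 0 ≤ β)
    (hβd : β < d) :
    ∃ C : ℝ≥0∞, C ≠ ⊤ ∧ ∀ (x : E) (r : ℝ), 0 < r →
      ∫⁻ y in Metric.ball x r, ‖x - y‖ₑ ^ (-β) ≤ C * ENNReal.ofReal r ^ (d - β) := by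
  obtain ⟨C, hC, h⟩ := exists_lintegral_ball_le (E := E) hβd hβ
  exact ⟨C * volume (Metric.ball (0 : E) 1), ENNReal.mul_ne_top hC volume_unit_ball_ne_top,
    fun x r hr ↦ h volume x _ (fun s hs ↦ (volume_ball_eq_rpow hd x hs).le) r hr⟩

theorem exists_lintegral_compl_ball_rpow_le (hd : (Module.finrank ℝ E : ℝ) = d) {β : ℝ}
    (hβ : 0 ≤ β) (hβd : d < β) :
    ∃ C : ℝ≥0∞, C ≠ ⊤ ∧ ∀ (x : E) (r : ℝ), 0 < r →
      ∫⁻ y in (Metric.ball x r)ᶜ, ‖x - y‖ₑ ^ (-β) ≤ C * ENNReal.ofReal r ^ (d - β) := by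
  obtain ⟨C, hC, h⟩ := exists_lintegral_compl_ball_le (E := E) hβd hβ
  exact ⟨C * volume (Metric.ball (0 : E) 1), ENNReal.mul_ne_top hC volume_unit_ball_ne_top,
    fun x r hr ↦ h volume x _ (fun s hs ↦ (volume_ball_eq_rpow hd x hs).le) r hr⟩

theorem rpow_neg_mul_rpow_neg_le {u v : ℝ≥0∞} (hu : u ≠ 0) (hv : v ≠ 0) (hu' : u ≠ ⊤)
    (hv' : v ≠ ⊤) {b c : ℝ} (hb : 0 ≤ b) (hc : 0 ≤ c) :
    u ^ (-b) * v ^ (-c) ≤ u ^ (-(b + c)) + v ^ (-(b + c)) := by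
  rw [neg_add, ENNReal.rpow_add _ _ hu hu', ENNReal.rpow_add _ _ hv hv']
  rcases le_total u v with h | h
  · refine le_trans ?_ le_self_add
    gcongr _ * ?_
    exact rpow_anti_of_nonpos h (by linarith)
  · refine le_trans ?_ le_add_self
    gcongr ?_ * _
    exact rpow_anti_of_nonpos h (by linarith)

/-- Composition of Riesz kernels: convolving `|x|^{α-d}` with `|x|^{-γ}` gives at most a multiple
of `|x|^{α-γ}`. -/
theorem exists_lintegral_riesz_comp_le (hd : (Module.finrank ℝ E : ℝ) = d) {α γ : ℝ}
    (hα : 0 < α) (hαγ : α < γ) (hγ : γ < d) :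
    ∃ C : ℝ≥0∞, C ≠ ⊤ ∧ ∀ x : E, x ≠ 0 →
      ∫⁻ y, ‖x - y‖ₑ ^ (-(d - α)) * ‖y‖ₑ ^ (-γ) ≤ C * ‖x‖ₑ ^ (α - γ) := by
  obtain ⟨C₁, hC₁, h₁⟩ := exists_lintegral_ball_rpow_le hd (E := E) (β := γ) (by linarith) hγ
  obtain ⟨C₂, hC₂, h₂⟩ := exists_lintegral_ball_rpow_le hd (E := E) (β := d - α) (by linarith)
    (by linarith)
  obtain ⟨C₃, hC₃, h₃⟩ := exists_lintegral_compl_ball_rpow_le hd (E := E) (β := (d - α) + γ)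
    (by linarith) (by linarith)
  refine ⟨(C₁ + C₂ + (C₃ + C₃)) * 2⁻¹ ^ (α - γ), ENNReal.mul_ne_top (by finiteness)
    (rpow_ne_top_of_ne (by simp) (by simp) _), fun x hx ↦ ?_⟩
  -- away from both singularities, the balls of radius `‖x‖ / 2` about `0` and `x`, the product of
  -- the kernels is controlled by the sum of their tails
  set r : ℝ := ‖x‖ / 2 with hr
  have hr0 : 0 < r := by have := norm_pos_iff.2 hx; positivity
  have hcov : (Set.univ : Set E) ⊆ (Metric.ball 0 r ∪ Metric.ball x r) ∪
      (Metric.ball 0 r ∪ Metric.ball x r)ᶜ := by rw [Set.union_compl_self]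
  have e₁ : ∫⁻ y in Metric.ball 0 r, ‖x - y‖ₑ ^ (-(d - α)) * ‖y‖ₑ ^ (-γ) ≤
      C₁ * ENNReal.ofReal r ^ (α - γ) := by
    calc _ ≤ ∫⁻ y in Metric.ball 0 r, ENNReal.ofReal r ^ (-(d - α)) * ‖(0 : E) - y‖ₑ ^ (-γ) := by
          refine setLIntegral_mono' measurableSet_ball fun y hy ↦ ?_
          rw [zero_sub, enorm_neg]
          gcongr ?_ * _
          refine rpow_anti_of_nonpos (le_enorm_sub_of_notMem_ball fun h ↦ ?_) (by linarith)
          have h1 := dist_triangle_right x 0 y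
          rw [dist_zero_right, dist_comm x y, dist_comm 0 y] at h1
          rw [Metric.mem_ball] at h hy
          linarith
      _ ≤ ENNReal.ofReal r ^ (-(d - α)) * (C₁ * ENNReal.ofReal r ^ (d - γ)) := by
          rw [lintegral_const_mul' _ _ (ofReal_rpow_ne_top hr0 _)]
          gcongr
          exact h₁ 0 r hr0
      _ = _ := by
          rw [mul_left_comm, ofReal_rpow_mul_rpow hr0]; ring_nf
  have e₂ : ∫⁻ y in Metric.ball x r, ‖x - y‖ₑ ^ (-(d - α)) * ‖y‖ₑ ^ (-γ) ≤
      C₂ * ENNReal.ofReal r ^ (α - γ) := by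
    calc _ ≤ ∫⁻ y in Metric.ball x r, ENNReal.ofReal r ^ (-γ) * ‖x - y‖ₑ ^ (-(d - α)) := by
          refine setLIntegral_mono' measurableSet_ball fun y hy ↦ ?_
          rw [mul_comm]
          gcongr ?_ * _
          have : ‖y‖ₑ = ‖(0 : E) - y‖ₑ := by rw [zero_sub, enorm_neg]
          rw [this]
          refine rpow_anti_of_nonpos (le_enorm_sub_of_notMem_ball fun h ↦ ?_) (by linarith)
          have h1 := dist_triangle_right x 0 y
          rw [dist_zero_right, dist_comm x y, dist_comm 0 y] at h1
          rw [Metric.mem_ball] at h hy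
          linarith
      _ ≤ ENNReal.ofReal r ^ (-γ) * (C₂ * ENNReal.ofReal r ^ (d - (d - α))) := by
          rw [lintegral_const_mul' _ _ (ofReal_rpow_ne_top hr0 _)]
          gcongr
          exact h₂ x r hr0
      _ = _ := by
          rw [mul_left_comm, ofReal_rpow_mul_rpow hr0]; ring_nf
  have e₃ : ∫⁻ y in (Metric.ball 0 r ∪ Metric.ball x r)ᶜ, ‖x - y‖ₑ ^ (-(d - α)) * ‖y‖ₑ ^ (-γ) ≤
      (C₃ + C₃) * ENNReal.ofReal r ^ (α - γ) := by
    have hr0' : 0 < ENNReal.ofReal r := by simpa using hr0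
    calc _ ≤ ∫⁻ y in (Metric.ball 0 r ∪ Metric.ball x r)ᶜ,
            (‖x - y‖ₑ ^ (-((d - α) + γ)) + ‖(0 : E) - y‖ₑ ^ (-((d - α) + γ))) := by
          refine setLIntegral_mono' (measurableSet_ball.union measurableSet_ball).compl
            fun y hy ↦ ?_
          rw [Set.mem_compl_iff, Set.mem_union, not_or] at hy
          have a1 := hr0'.trans_le (le_enorm_sub_of_notMem_ball hy.1)
          have a2 := hr0'.trans_le (le_enorm_sub_of_notMem_ball hy.2)
          rw [zero_sub, enorm_neg] at a1 ⊢
          exact rpow_neg_mul_rpow_neg_le a2.ne' a1.ne' (by finiteness) (by finiteness)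
            (by linarith) (by linarith)
      _ = (∫⁻ y in (Metric.ball 0 r ∪ Metric.ball x r)ᶜ, ‖x - y‖ₑ ^ (-((d - α) + γ))) +
            ∫⁻ y in (Metric.ball 0 r ∪ Metric.ball x r)ᶜ, ‖(0 : E) - y‖ₑ ^ (-((d - α) + γ)) :=
          lintegral_add_left (by fun_prop) _
      _ ≤ C₃ * ENNReal.ofReal r ^ (d - ((d - α) + γ)) +
            C₃ * ENNReal.ofReal r ^ (d - ((d - α) + γ)) := by
          gcongr
          · refine (lintegral_mono_set ?_).trans (h₃ x r hr0)
            exact Set.compl_subset_compl.2 Set.subset_union_right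
          · refine (lintegral_mono_set ?_).trans (h₃ 0 r hr0)
            exact Set.compl_subset_compl.2 Set.subset_union_left
      _ = _ := by
          rw [← add_mul]; ring_nf
  calc _ = ∫⁻ y in Set.univ, ‖x - y‖ₑ ^ (-(d - α)) * ‖y‖ₑ ^ (-γ) := by
        rw [setLIntegral_univ]
    _ ≤ _ := lintegral_mono_set hcov
    _ ≤ _ := (lintegral_union_le _ _ _).trans (add_le_add_left (lintegral_union_le _ _ _) _)
    _ ≤ (C₁ * ENNReal.ofReal r ^ (α - γ) + C₂ * ENNReal.ofReal r ^ (α - γ)) +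
          (C₃ + C₃) * ENNReal.ofReal r ^ (α - γ) := by gcongr
    _ = (C₁ + C₂ + (C₃ + C₃)) * ENNReal.ofReal r ^ (α - γ) := by ring
    _ = _ := by
        rw [hr, div_eq_mul_inv, ENNReal.ofReal_mul (norm_nonneg x), ofReal_norm,
          ENNReal.mul_rpow_of_ne_top (by finiteness) (by simp),
          ENNReal.ofReal_inv_of_pos two_pos]
        simp only [ENNReal.ofReal_ofNat]
        ring

/-- The Stein–Weiss inequality `‖|·|^{-α} I_α F‖_p ≤ C ‖F‖_p`, by Schur's test with the
weight `|y|^{-δ}`. -/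
theorem exists_lintegral_stein_weiss_le (hd : (Module.finrank ℝ E : ℝ) = d) {α p : ℝ}
    (hα : 0 < α) (hp : 1 < p) (hαp : α * p < d) :
    ∃ C : ℝ≥0∞, C ≠ ⊤ ∧ ∀ F : E → ℝ≥0∞, Measurable F →
      ∫⁻ x, (‖x‖ₑ ^ (-α) * ∫⁻ y, ‖x - y‖ₑ ^ (-(d - α)) * F y) ^ p ≤ C * ∫⁻ y, F y ^ p := by
  have hp0 : 0 < p := by linarith
  have hp1 : 0 < p - 1 := by linarith
  have hαd : α < d := by nlinarith
  -- the two applications of the composition bound need `α < δ < d` and `α + δ (p - 1) < d`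
  obtain ⟨δ, hδα, hδ⟩ : ∃ δ, α < δ ∧ δ < min d ((d - α) / (p - 1)) := by
    refine exists_between (lt_min hαd ?_)
    rw [lt_div_iff₀ hp1]; linarith
  obtain ⟨hδd, hδp⟩ := lt_min_iff.1 hδ
  rw [lt_div_iff₀ hp1] at hδp
  have hδp0 : 0 < δ * (p - 1) := mul_pos (by linarith) hp1
  obtain ⟨C₁, hC₁, h₁⟩ := exists_lintegral_riesz_comp_le hd (E := E) hα hδα hδd
  obtain ⟨C₂, hC₂, h₂⟩ := exists_lintegral_riesz_comp_le hd (E := E) (γ := α + δ * (p - 1)) hα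
    (by linarith) (by linarith)
  refine ⟨C₁ ^ (p - 1) * C₂, ENNReal.mul_ne_top (by finiteness) hC₂, fun F hF ↦ ?_⟩
  have hne : ∀ᵐ x : E, x ≠ 0 := by
    simp [ae_iff, measure_singleton]
  have hC₁p : C₁ ^ (p - 1) ≠ ⊤ := by finiteness
  calc _ ≤ ∫⁻ x, C₁ ^ (p - 1) * (‖x‖ₑ ^ (-(α + δ * (p - 1))) *
            ∫⁻ y, ‖x - y‖ₑ ^ (-(d - α)) * (‖y‖ₑ ^ (δ * (p - 1)) * F y ^ p)) := by
        refine lintegral_mono_ae ?_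
        filter_upwards [hne] with x hx
        have hx0 : ‖x‖ₑ ≠ 0 := by simpa using hx
        have hx1 : ‖x‖ₑ ≠ ⊤ := by finiteness
        have e1 : ∫⁻ y, ‖x - y‖ₑ ^ (-(d - α)) * F y =
            ∫⁻ y, (‖x - y‖ₑ ^ (-(d - α)) * ‖y‖ₑ ^ (-δ)) ^ ((p - 1) / p) *
              (‖x - y‖ₑ ^ (-(d - α)) * (‖y‖ₑ ^ (δ * (p - 1)) * F y ^ p)) ^ (1 / p) := by
          refine lintegral_congr_ae ?_
          filter_upwards [hne] with y hy
          have hy0 : ‖y‖ₑ ≠ 0 := by simpa using hy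
          have hy1 : ‖y‖ₑ ≠ ⊤ := by finiteness
          have i1 : 0 ≤ (p - 1) / p := div_nonneg hp1.le hp0.le
          have i2 : 0 ≤ 1 / p := by positivity
          generalize ‖x - y‖ₑ ^ (-(d - α)) = k
          rw [ENNReal.mul_rpow_of_nonneg _ _ i1, ENNReal.mul_rpow_of_nonneg _ _ i2,
            ENNReal.mul_rpow_of_nonneg _ _ i2, ← ENNReal.rpow_mul, ← ENNReal.rpow_mul,
            ← ENNReal.rpow_mul (F y), mul_one_div_cancel hp0.ne', ENNReal.rpow_one]
          calc k * F y = k ^ ((p - 1) / p + 1 / p) *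
                ‖y‖ₑ ^ (-δ * ((p - 1) / p) + δ * (p - 1) * (1 / p)) * F y := by
                rw [← add_div, sub_add_cancel, div_self hp0.ne', ENNReal.rpow_one,
                  show -δ * ((p - 1) / p) + δ * (p - 1) * (1 / p) = 0 by ring,
                  ENNReal.rpow_zero, mul_one]
            _ = _ := by
                rw [ENNReal.rpow_add_of_nonneg _ _ i1 i2, ENNReal.rpow_add _ _ hy0 hy1]
                ring
        calc _ ≤ (‖x‖ₑ ^ (-α)) ^ p * ((C₁ * ‖x‖ₑ ^ (α - δ)) ^ (p - 1) *
                ∫⁻ y, ‖x - y‖ₑ ^ (-(d - α)) * (‖y‖ₑ ^ (δ * (p - 1)) * F y ^ p)) := by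
              rw [ENNReal.mul_rpow_of_nonneg _ _ hp0.le, e1]
              gcongr
              refine (rpow_lintegral_mul_le hp (by fun_prop) (by fun_prop)).trans ?_
              gcongr
              exact h₁ x hx
          _ = _ := by
              rw [ENNReal.mul_rpow_of_nonneg _ _ hp1.le, ← ENNReal.rpow_mul, ← ENNReal.rpow_mul,
                show -(α + δ * (p - 1)) = -α * p + (α - δ) * (p - 1) by ring,
                ENNReal.rpow_add _ _ hx0 hx1]
              ring
    _ = C₁ ^ (p - 1) * ∫⁻ x, ∫⁻ y, ‖x‖ₑ ^ (-(α + δ * (p - 1))) *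
            (‖x - y‖ₑ ^ (-(d - α)) * (‖y‖ₑ ^ (δ * (p - 1)) * F y ^ p)) := by
        rw [lintegral_const_mul' _ _ hC₁p]
        congr 2 with x
        rw [lintegral_const_mul _ (by fun_prop)]
    _ = C₁ ^ (p - 1) * ∫⁻ y, ∫⁻ x, ‖x‖ₑ ^ (-(α + δ * (p - 1))) *
            (‖x - y‖ₑ ^ (-(d - α)) * (‖y‖ₑ ^ (δ * (p - 1)) * F y ^ p)) := by
        rw [lintegral_lintegral_swap]
        unfold Function.uncurry
        fun_prop
    _ ≤ C₁ ^ (p - 1) * ∫⁻ y, C₂ * F y ^ p := by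
        gcongr 1
        refine lintegral_mono_ae ?_
        filter_upwards [hne] with y hy
        have hy0 : ‖y‖ₑ ≠ 0 := by simpa using hy
        have hy1 : ‖y‖ₑ ≠ ⊤ := by finiteness
        calc _ = (∫⁻ x, ‖y - x‖ₑ ^ (-(d - α)) * ‖x‖ₑ ^ (-(α + δ * (p - 1)))) *
              (‖y‖ₑ ^ (δ * (p - 1)) * F y ^ p) := by
              rw [← lintegral_mul_const _ (by fun_prop)]
              congr 1 with x
              rw [enorm_sub_rev]; ring
          _ ≤ (C₂ * ‖y‖ₑ ^ (α - (α + δ * (p - 1)))) * (‖y‖ₑ ^ (δ * (p - 1)) * F y ^ p) := by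
              gcongr
              exact h₂ y hy
          _ = C₂ * (‖y‖ₑ ^ (α - (α + δ * (p - 1)) + δ * (p - 1)) * F y ^ p) := by
              rw [ENNReal.rpow_add _ _ hy0 hy1]; ring
          _ = _ := by
              rw [show α - (α + δ * (p - 1)) + δ * (p - 1) = 0 by ring, ENNReal.rpow_zero, one_mul]
    _ = _ := by
        rw [lintegral_const_mul' _ _ hC₂]; ring

end Kernel

/-! ### The weighted Riesz potential under Morrey bounds -/

section MorreyBound

variable {E : Type*} [NormedAddCommGroup E] [InnerProductSpace ℝ E] [FiniteDimensional ℝ E]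
  [Nontrivial E] [MeasurableSpace E] [BorelSpace E] {d : ℝ}

/-- The truncated Riesz potential is convolution with a kernel of mass `≲ R^α`, so it preserves
`p`-th power bounds on balls, by Hölder's inequality and translation invariance. -/
theorem exists_lintegral_riesz_near_le (hd : (Module.finrank ℝ E : ℝ) = d) {α p l : ℝ}
    (hα : 0 < α) (hαd : α < d) (hp : 1 < p) :
    ∃ C : ℝ≥0∞, C ≠ ⊤ ∧ ∀ F : E → ℝ≥0∞, Measurable F → ∀ M : ℝ≥0∞,
      (∀ (a : E) (r : ℝ), 0 < r →
        ∫⁻ y in Metric.ball a r, F y ^ p ≤ M * ENNReal.ofReal r ^ l) →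
      ∀ (a : E) (r R : ℝ), 0 < r → 0 < R →
        ∫⁻ x in Metric.ball a r,
          (∫⁻ y in Metric.ball x R, ‖x - y‖ₑ ^ (-(d - α)) * F y) ^ p ≤
          C * ENNReal.ofReal R ^ (α * p) * (M * ENNReal.ofReal r ^ l) := by
  have hp0 : 0 < p := by linarith
  obtain ⟨C, hC, h⟩ := exists_lintegral_ball_rpow_le hd (E := E) (β := d - α) (by linarith)
    (by linarith)
  have h' : ∀ R : ℝ, 0 < R →
      ∫⁻ z in Metric.ball (0 : E) R, ‖z‖ₑ ^ (-(d - α)) ≤ C * ENNReal.ofReal R ^ α := by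
    intro R hR
    have := h 0 R hR
    simpa only [zero_sub, enorm_neg, sub_sub_cancel] using this
  refine ⟨C ^ p, by finiteness, fun F hF M hM a r R hr hR ↦ ?_⟩
  have htrans : ∀ x : E, ∫⁻ y in Metric.ball x R, ‖x - y‖ₑ ^ (-(d - α)) * F y =
      ∫⁻ z in Metric.ball (0 : E) R, ‖z‖ₑ ^ (-(d - α)) * F (x - z) := by
    intro x
    rw [← lintegral_indicator measurableSet_ball, ← lintegral_indicator measurableSet_ball,
      ← lintegral_sub_left_eq_self _ x]
    congr 1 with z
    classical
    simp only [Set.indicator_apply, Metric.mem_ball, dist_self_sub_left, dist_zero_right,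
      sub_sub_cancel]
  have hball : ∀ z : E, ∫⁻ x in Metric.ball a r, F (x - z) ^ p ≤ M * ENNReal.ofReal r ^ l := by
    intro z
    refine le_trans (le_of_eq ?_) (hM (a - z) r hr)
    rw [← lintegral_indicator measurableSet_ball, ← lintegral_indicator measurableSet_ball,
      ← lintegral_sub_right_eq_self ((Metric.ball (a - z) r).indicator fun x ↦ F x ^ p) z]
    congr 1 with x
    classical
    simp only [Set.indicator_apply, Metric.mem_ball, dist_sub_right]
  simp only [htrans]
  calc _ ≤ ∫⁻ x in Metric.ball a r, (C * ENNReal.ofReal R ^ α) ^ (p - 1) *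
          ∫⁻ z in Metric.ball (0 : E) R, ‖z‖ₑ ^ (-(d - α)) * F (x - z) ^ p := by
        refine lintegral_mono fun x ↦ ?_
        refine (rpow_lintegral_kernel_mul_le hp (by fun_prop) (by fun_prop)).trans ?_
        gcongr
        exact h' R hR
    _ = (C * ENNReal.ofReal R ^ α) ^ (p - 1) * ∫⁻ x in Metric.ball a r,
          ∫⁻ z in Metric.ball (0 : E) R, ‖z‖ₑ ^ (-(d - α)) * F (x - z) ^ p := by
        rw [lintegral_const_mul']
        exact ENNReal.rpow_ne_top_of_nonneg (by linarith)
          (ENNReal.mul_ne_top hC (ofReal_rpow_ne_top hR _))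
    _ = (C * ENNReal.ofReal R ^ α) ^ (p - 1) * ∫⁻ z in Metric.ball (0 : E) R,
          ∫⁻ x in Metric.ball a r, ‖z‖ₑ ^ (-(d - α)) * F (x - z) ^ p := by
        rw [lintegral_lintegral_swap]
        unfold Function.uncurry
        fun_prop
    _ ≤ (C * ENNReal.ofReal R ^ α) ^ (p - 1) * ∫⁻ z in Metric.ball (0 : E) R,
          ‖z‖ₑ ^ (-(d - α)) * (M * ENNReal.ofReal r ^ l) := by
        gcongr with z
        rw [lintegral_const_mul _ (by fun_prop)]
        gcongr
        exact hball z
    _ ≤ (C * ENNReal.ofReal R ^ α) ^ (p - 1) *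
          ((C * ENNReal.ofReal R ^ α) * (M * ENNReal.ofReal r ^ l)) := by
        rw [lintegral_mul_const _ (by fun_prop)]
        gcongr
        exact h' R hR
    _ = (C * ENNReal.ofReal R ^ α) ^ (p - 1 + 1) * (M * ENNReal.ofReal r ^ l) := by
        rw [ENNReal.rpow_add_of_nonneg _ _ (by linarith) one_pos.le, ENNReal.rpow_one]
        ring
    _ = _ := by
        rw [sub_add_cancel, ENNReal.mul_rpow_of_nonneg _ _ hp0.le, ← ENNReal.rpow_mul]

/-- The tail of the Riesz potential converges because `α < s`: on balls of radius `r` the measure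
`F dx` grows at most like `r^{d-s}`, by Hölder's inequality. -/
theorem exists_lintegral_riesz_far_le (hd : (Module.finrank ℝ E : ℝ) = d) {α p s : ℝ}
    (hαd : α < d) (hαs : α < s) (hp : 1 < p) :
    ∃ C : ℝ≥0∞, C ≠ ⊤ ∧ ∀ F : E → ℝ≥0∞, Measurable F → ∀ M : ℝ≥0∞,
      (∀ (a : E) (r : ℝ), 0 < r →
        ∫⁻ y in Metric.ball a r, F y ^ p ≤ M * ENNReal.ofReal r ^ (d - s * p)) →
      ∀ (x : E) (R : ℝ), 0 < R →
        (∫⁻ y in (Metric.ball x R)ᶜ, ‖x - y‖ₑ ^ (-(d - α)) * F y) ^ p ≤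
          C * M * ENNReal.ofReal R ^ ((α - s) * p) := by
  have hp0 : 0 < p := by linarith
  obtain ⟨C, hC, h⟩ := exists_lintegral_compl_ball_le (E := E) (κ := d - s) (β := d - α)
    (by linarith) (by linarith)
  set v := volume (Metric.ball (0 : E) 1)
  refine ⟨C ^ p * v ^ (p - 1), ENNReal.mul_ne_top (by finiteness)
    (ENNReal.rpow_ne_top_of_nonneg (by linarith) volume_unit_ball_ne_top),
    fun F hF M hM x R hR ↦ ?_⟩
  have hgrowth : ∀ r : ℝ, 0 < r → volume.withDensity F (Metric.ball x r) ≤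
      (v ^ (p - 1) * M) ^ (1 / p) * ENNReal.ofReal r ^ (d - s) := by
    intro r hr
    rw [withDensity_apply _ measurableSet_ball]
    have h1 := rpow_lintegral_kernel_mul_le (μ := volume.restrict (Metric.ball x r)) hp
      (k := fun _ ↦ 1) (by fun_prop) (hF.aemeasurable)
    simp only [one_mul, lintegral_const, Measure.restrict_apply_univ] at h1
    calc _ = ((∫⁻ y in Metric.ball x r, F y) ^ p) ^ (1 / p) := by
          rw [← ENNReal.rpow_mul, mul_one_div_cancel hp0.ne', ENNReal.rpow_one]
      _ ≤ ((v * ENNReal.ofReal r ^ d) ^ (p - 1) * (M * ENNReal.ofReal r ^ (d - s * p))) ^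
            (1 / p) := by
          gcongr
          refine h1.trans ?_
          rw [volume_ball_eq_rpow hd x hr]
          gcongr
          exact hM x r hr
      _ = ((v ^ (p - 1) * M) * ENNReal.ofReal r ^ ((d - s) * p)) ^ (1 / p) := by
          rw [ENNReal.mul_rpow_of_nonneg (z := p - 1) _ _ (by linarith), ← ENNReal.rpow_mul,
            show (d - s) * p = d * (p - 1) + (d - s * p) by ring, ← ofReal_rpow_mul_rpow hr]
          ring_nf
      _ = _ := by
          rw [ENNReal.mul_rpow_of_nonneg _ _ (by positivity), ← ENNReal.rpow_mul, mul_assoc,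
            mul_one_div_cancel hp0.ne', mul_one]
  have h2 := h _ x _ hgrowth R hR
  rw [setLIntegral_withDensity_eq_setLIntegral_mul _ hF (by fun_prop)
    measurableSet_ball.compl] at h2
  simp only [Pi.mul_apply, mul_comm (F _)] at h2
  calc _ ≤ (C * (v ^ (p - 1) * M) ^ (1 / p) * ENNReal.ofReal R ^ (d - s - (d - α))) ^ p := by
        gcongr
    _ = _ := by
        rw [ENNReal.mul_rpow_of_nonneg _ _ hp0.le, ENNReal.mul_rpow_of_nonneg _ _ hp0.le,
          ← ENNReal.rpow_mul, ← ENNReal.rpow_mul, one_div_mul_cancel hp0.ne', ENNReal.rpow_one]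
        ring_nf

/-- The weighted Riesz potential `|·|^{-α} I_α` preserves Morrey bounds: with `s = d / q`, the
hypothesis and the conclusion say that `F` and `|·|^{-α} I_α F` lie in the Morrey space with
exponents `p, q`. -/
theorem exists_morrey_weighted_riesz_le (hd : (Module.finrank ℝ E : ℝ) = d) {α p s : ℝ}
    (hα : 0 < α) (hαs : α < s) (hp : 1 < p) (hsp : s * p ≤ d) :
    ∃ C : ℝ≥0∞, C ≠ ⊤ ∧ ∀ F : E → ℝ≥0∞, Measurable F → ∀ M : ℝ≥0∞,
      (∀ (a : E) (r : ℝ), 0 < r →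
        ∫⁻ y in Metric.ball a r, F y ^ p ≤ M * ENNReal.ofReal r ^ (d - s * p)) →
      ∀ (a : E) (r : ℝ), 0 < r →
        ∫⁻ x in Metric.ball a r, (‖x‖ₑ ^ (-α) * ∫⁻ y, ‖x - y‖ₑ ^ (-(d - α)) * F y) ^ p ≤
          C * M * ENNReal.ofReal r ^ (d - s * p) := by
  have hp0 : 0 < p := by linarith
  have hαp : α * p < d := by nlinarith
  have hαd : α < d := by nlinarith
  obtain ⟨C₁, hC₁, h₁⟩ := exists_lintegral_stein_weiss_le hd (E := E) hα hp hαp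
  obtain ⟨C₂, hC₂, h₂⟩ := exists_lintegral_riesz_near_le hd (E := E) (l := d - s * p) hα hαd hp
  obtain ⟨C₃, hC₃, h₃⟩ := exists_lintegral_riesz_far_le hd (E := E) hαd hαs hp
  obtain ⟨C₄, hC₄, h₄⟩ := exists_lintegral_ball_rpow_le hd (E := E) (β := α * p) (by positivity)
    hαp
  set v := volume (Metric.ball (0 : E) 1)
  have hv : v ≠ ⊤ := volume_unit_ball_ne_top
  -- the constants of the near and far parts for balls near the origin and for distant balls
  set A₁ : ℝ≥0∞ := C₁ * 6 ^ (d - s * p)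
  set A₂ : ℝ≥0∞ := C₃ * C₄ * 3 ^ (d - s * p)
  set B₁ : ℝ≥0∞ := 2⁻¹ ^ (-α * p) * C₂
  set B₂ : ℝ≥0∞ := 2⁻¹ ^ (-α * p) * (C₃ * v)
  have hpow2 : (2⁻¹ : ℝ≥0∞) ^ (-α * p) ≠ ⊤ := rpow_ne_top_of_ne (by simp) (by simp) _
  refine ⟨2 ^ (p - 1) * ((A₁ + A₂) + (B₁ + B₂)), ?_, fun F hF M hM a r hr ↦ ?_⟩
  · have h6 : (6 : ℝ≥0∞) ^ (d - s * p) ≠ ⊤ := rpow_ne_top_of_ne (by simp) (by simp) _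
    have h3 : (3 : ℝ≥0∞) ^ (d - s * p) ≠ ⊤ := rpow_ne_top_of_ne (by simp) (by simp) _
    have h2 : (2 : ℝ≥0∞) ^ (p - 1) ≠ ⊤ := rpow_ne_top_of_ne (by simp) (by simp) _
    finiteness
  have hmeas : ∀ R : ℝ, Measurable fun x : E ↦
      ∫⁻ y in Metric.ball x R, ‖x - y‖ₑ ^ (-(d - α)) * F y := by
    intro R
    have : ∀ x : E, ∫⁻ y in Metric.ball x R, ‖x - y‖ₑ ^ (-(d - α)) * F y =
        ∫⁻ y, {z : E × E | dist z.2 z.1 < R}.indicator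
          (fun z ↦ ‖z.1 - z.2‖ₑ ^ (-(d - α)) * F z.2) (x, y) := by
      intro x
      rw [← lintegral_indicator measurableSet_ball]
      rfl
    simp only [this]
    refine Measurable.lintegral_prod_right' (Measurable.indicator (by fun_prop) ?_)
    exact measurableSet_lt (by fun_prop) measurable_const
  -- splitting the potential at distance `R` and bounding its far part uniformly in `x`
  have hsplit : ∀ R : ℝ, 0 < R → ∫⁻ x in Metric.ball a r,
      (‖x‖ₑ ^ (-α) * ∫⁻ y, ‖x - y‖ₑ ^ (-(d - α)) * F y) ^ p ≤ 2 ^ (p - 1) *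
      ((∫⁻ x in Metric.ball a r, (‖x‖ₑ ^ (-α) *
          ∫⁻ y in Metric.ball x R, ‖x - y‖ₑ ^ (-(d - α)) * F y) ^ p) +
        ∫⁻ x in Metric.ball a r, ‖x‖ₑ ^ (-α * p) *
          (C₃ * M * ENNReal.ofReal R ^ ((α - s) * p))) := by
    intro R hR
    rw [← lintegral_add_left (by have := hmeas R; fun_prop),
      ← lintegral_const_mul' _ _ (rpow_ne_top_of_ne (by simp) (by simp) _)]
    refine lintegral_mono fun x ↦ ?_
    rw [← lintegral_add_compl _ (measurableSet_ball (x := x) (ε := R)), mul_add]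
    refine (ENNReal.rpow_add_le_mul_rpow_add_rpow _ _ hp.le).trans ?_
    gcongr
    rw [ENNReal.mul_rpow_of_nonneg _ _ hp0.le, ← ENNReal.rpow_mul]
    gcongr
    exact h₃ F hF M hM x R hR
  rcases lt_or_ge ‖a‖ (2 * r) with ha | ha
  · -- the ball meets the region near the origin, where only the global estimate is available
    have hsub : Metric.ball a r ⊆ Metric.ball 0 (3 * r) := by
      apply Metric.ball_subset_ball'
      rw [dist_zero_right]; linarith
    have near : ∫⁻ x in Metric.ball a r, (‖x‖ₑ ^ (-α) *
        ∫⁻ y in Metric.ball x (3 * r), ‖x - y‖ₑ ^ (-(d - α)) * F y) ^ p ≤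
        A₁ * M * ENNReal.ofReal r ^ (d - s * p) := by
      set G : E → ℝ≥0∞ := (Metric.ball 0 (6 * r)).indicator F
      calc _ ≤ ∫⁻ x in Metric.ball a r, (‖x‖ₑ ^ (-α) *
            ∫⁻ y, ‖x - y‖ₑ ^ (-(d - α)) * G y) ^ p := by
            refine setLIntegral_mono' measurableSet_ball fun x hx ↦ ?_
            gcongr (_ * ?_) ^ p
            rw [← lintegral_indicator measurableSet_ball]
            refine lintegral_mono fun y ↦ ?_
            by_cases hy : y ∈ Metric.ball x (3 * r)
            swap
            · simp [Set.indicator_of_notMem hy]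
            rw [Set.indicator_of_mem hy]
            have hy' : y ∈ Metric.ball (0 : E) (6 * r) := by
              have := hsub hx
              have h1 := dist_triangle y x 0
              rw [Metric.mem_ball] at *
              linarith
            simp only [G, Set.indicator_of_mem hy', le_refl]
        _ ≤ C₁ * ∫⁻ y, G y ^ p :=
            (setLIntegral_le_lintegral _ _).trans (h₁ G (hF.indicator measurableSet_ball))
        _ = C₁ * ∫⁻ y in Metric.ball 0 (6 * r), F y ^ p := by
            rw [← lintegral_indicator measurableSet_ball]
            congr 2 with y
            classical
            simp only [G, Set.indicator_apply]
            split_ifs <;> simp [hp0]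
        _ ≤ C₁ * (M * ENNReal.ofReal (6 * r) ^ (d - s * p)) := by
            gcongr
            exact hM 0 _ (by positivity)
        _ = _ := by
            rw [ENNReal.ofReal_mul (by norm_num), ENNReal.mul_rpow_of_ne_top (by simp) (by simp)]
            simp only [ENNReal.ofReal_ofNat, A₁]
            ring
    have far : ∫⁻ x in Metric.ball a r, ‖x‖ₑ ^ (-α * p) *
        (C₃ * M * ENNReal.ofReal (3 * r) ^ ((α - s) * p)) ≤
        A₂ * M * ENNReal.ofReal r ^ (d - s * p) := by
      have h3r : 0 < 3 * r := by positivity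
      rw [lintegral_mul_const _ (by fun_prop)]
      calc _ ≤ (C₄ * ENNReal.ofReal (3 * r) ^ (d - α * p)) *
            (C₃ * M * ENNReal.ofReal (3 * r) ^ ((α - s) * p)) := by
            gcongr
            have := h₄ 0 (3 * r) h3r
            simp only [zero_sub, enorm_neg] at this
            rw [neg_mul]
            exact (lintegral_mono_set hsub).trans this
        _ = C₃ * C₄ * M * ENNReal.ofReal (3 * r) ^ (d - s * p) := by
            rw [show d - s * p = d - α * p + (α - s) * p by ring, ← ofReal_rpow_mul_rpow h3r]
            ring
        _ = _ := by
            rw [ENNReal.ofReal_mul (by norm_num), ENNReal.mul_rpow_of_ne_top (by simp) (by simp)]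
            simp only [ENNReal.ofReal_ofNat, A₂]
            ring
    calc _ ≤ _ := hsplit (3 * r) (by positivity)
      _ ≤ 2 ^ (p - 1) * (A₁ * M * ENNReal.ofReal r ^ (d - s * p) +
            A₂ * M * ENNReal.ofReal r ^ (d - s * p)) := by gcongr
      _ = 2 ^ (p - 1) * (A₁ + A₂) * M * ENNReal.ofReal r ^ (d - s * p) := by ring
      _ ≤ _ := by gcongr 2 ^ (p - 1) * ?_ * M * _; exact le_self_add
  · -- on a ball away from the origin the weight is comparable to the constant `‖a‖ ^ (-α)`
    have ha0 : 0 < ‖a‖ := by linarith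
    have hw : ∀ x ∈ Metric.ball a r, ‖x‖ₑ ^ (-α * p) ≤
        2⁻¹ ^ (-α * p) * ENNReal.ofReal ‖a‖ ^ (-α * p) := by
      intro x hx
      rw [← ENNReal.mul_rpow_of_ne_top (by simp) (by simp)]
      refine rpow_anti_of_nonpos ?_ (by nlinarith)
      rw [← ofReal_norm x, ← ENNReal.ofReal_ofNat 2, ← ENNReal.ofReal_inv_of_pos two_pos,
        ← ENNReal.ofReal_mul (by norm_num)]
      apply ENNReal.ofReal_le_ofReal
      rw [Metric.mem_ball, dist_eq_norm] at hx
      have := norm_sub_norm_le a x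
      rw [norm_sub_rev] at this
      linarith
    have near : ∫⁻ x in Metric.ball a r, (‖x‖ₑ ^ (-α) *
        ∫⁻ y in Metric.ball x ‖a‖, ‖x - y‖ₑ ^ (-(d - α)) * F y) ^ p ≤
        B₁ * M * ENNReal.ofReal r ^ (d - s * p) := by
      calc _ ≤ ∫⁻ x in Metric.ball a r, (2⁻¹ ^ (-α * p) * ENNReal.ofReal ‖a‖ ^ (-α * p)) *
            (∫⁻ y in Metric.ball x ‖a‖, ‖x - y‖ₑ ^ (-(d - α)) * F y) ^ p := by
            refine setLIntegral_mono' measurableSet_ball fun x hx ↦ ?_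
            rw [ENNReal.mul_rpow_of_nonneg _ _ hp0.le, ← ENNReal.rpow_mul]
            gcongr ?_ * _
            exact hw x hx
        _ ≤ (2⁻¹ ^ (-α * p) * ENNReal.ofReal ‖a‖ ^ (-α * p)) *
              (C₂ * ENNReal.ofReal ‖a‖ ^ (α * p) * (M * ENNReal.ofReal r ^ (d - s * p))) := by
            rw [lintegral_const_mul' _ _ (ENNReal.mul_ne_top hpow2 (ofReal_rpow_ne_top ha0 _))]
            gcongr
            exact h₂ F hF M hM a r ‖a‖ hr ha0
        _ = B₁ * M * ENNReal.ofReal r ^ (d - s * p) *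
              (ENNReal.ofReal ‖a‖ ^ (-α * p) * ENNReal.ofReal ‖a‖ ^ (α * p)) := by
            simp only [B₁]; ring
        _ = _ := by
            rw [ofReal_rpow_mul_rpow ha0, show -α * p + α * p = 0 by ring, ENNReal.rpow_zero,
              mul_one]
    have far : ∫⁻ x in Metric.ball a r, ‖x‖ₑ ^ (-α * p) *
        (C₃ * M * ENNReal.ofReal ‖a‖ ^ ((α - s) * p)) ≤
        B₂ * M * ENNReal.ofReal r ^ (d - s * p) := by
      rw [lintegral_mul_const _ (by fun_prop)]
      calc _ ≤ (2⁻¹ ^ (-α * p) * ENNReal.ofReal ‖a‖ ^ (-α * p) * (v * ENNReal.ofReal r ^ d)) *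
            (C₃ * M * ENNReal.ofReal ‖a‖ ^ ((α - s) * p)) := by
            gcongr
            refine (setLIntegral_mono' measurableSet_ball hw).trans ?_
            rw [setLIntegral_const, volume_ball_eq_rpow hd a hr]
        _ = B₂ * M * ENNReal.ofReal r ^ d *
              (ENNReal.ofReal ‖a‖ ^ (-α * p) * ENNReal.ofReal ‖a‖ ^ ((α - s) * p)) := by
            simp only [B₂]; ring
        _ ≤ B₂ * M * ENNReal.ofReal r ^ d * ENNReal.ofReal r ^ (-(s * p)) := by
            rw [ofReal_rpow_mul_rpow ha0, show -α * p + (α - s) * p = -(s * p) by ring]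
            gcongr _ * ?_
            exact rpow_anti_of_nonpos (ENNReal.ofReal_le_ofReal (by linarith)) (by nlinarith)
        _ = _ := by
            rw [mul_assoc, ofReal_rpow_mul_rpow hr, ← sub_eq_add_neg]
    calc _ ≤ _ := hsplit ‖a‖ ha0
      _ ≤ 2 ^ (p - 1) * (B₁ * M * ENNReal.ofReal r ^ (d - s * p) +
            B₂ * M * ENNReal.ofReal r ^ (d - s * p)) := by gcongr
      _ = 2 ^ (p - 1) * (B₁ + B₂) * M * ENNReal.ofReal r ^ (d - s * p) := by ring
      _ ≤ _ := by gcongr 2 ^ (p - 1) * ?_ * M * _; exact le_add_self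

end MorreyBound

/-! ### Superposition of dilated Fourier multipliers -/

section Profile

/-- The radial profile `u ↦ u^{2m} χ(u²)`, where `χ` is a smooth bump at the origin of the real
line. The even powers make `ξ ↦ bumpProfile m ‖ξ‖` smooth. -/
noncomputable def bumpProfile (m : ℕ) (u : ℝ) : ℝ :=
  (u ^ 2) ^ m * (default : ContDiffBump (0 : ℝ)) (u ^ 2)

theorem bumpProfile_nonneg (m : ℕ) (u : ℝ) : 0 ≤ bumpProfile m u :=
  mul_nonneg (by positivity) (ContDiffBump.nonneg _)

theorem bumpProfile_le (m : ℕ) (u : ℝ) : bumpProfile m u ≤ (u ^ 2) ^ m :=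
  mul_le_of_le_one_right (by positivity) (ContDiffBump.le_one _)

theorem bumpProfile_eq_zero (m : ℕ) {u : ℝ} (hu : 2 ≤ |u|) : bumpProfile m u = 0 := by
  rw [bumpProfile, ContDiffBump.zero_of_le_dist _ (?_), mul_zero]
  have : (default : ContDiffBump (0 : ℝ)).rOut = 2 := rfl
  rw [this, Real.dist_eq, sub_zero, abs_pow]
  nlinarith

theorem bumpProfile_of_abs_le_one (m : ℕ) {u : ℝ} (hu : |u| ≤ 1) :
    bumpProfile m u = (u ^ 2) ^ m := by
  rw [bumpProfile, ContDiffBump.one_of_mem_closedBall, mul_one]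
  have : (default : ContDiffBump (0 : ℝ)).rIn = 1 := rfl
  rw [this, mem_closedBall_zero_iff, Real.norm_eq_abs, abs_pow]
  exact pow_le_one₀ (abs_nonneg u) hu

theorem bumpProfile_eq_mul (m : ℕ) (u : ℝ) : bumpProfile m u = (u ^ 2) ^ m * bumpProfile 0 u := by
  simp [bumpProfile]

theorem continuous_bumpProfile (m : ℕ) : Continuous (bumpProfile m) := by
  unfold bumpProfile
  exact ((continuous_id.pow 2).pow m).mul ((ContDiffBump.continuous _).comp (continuous_id.pow 2))

theorem integrableOn_rpow_mul_bumpProfile (m : ℕ) {β : ℝ} (hβ : 0 < 2 * m + β) :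
    IntegrableOn (fun u : ℝ ↦ u ^ (β - 1) * bumpProfile m u) (Set.Ioi 0) := by
  have h1 : IntegrableOn (fun u : ℝ ↦ u ^ (2 * m + β - 1)) (Set.Ioo 0 2) :=
    (intervalIntegral.integrableOn_Ioo_rpow_iff two_pos).2 (by linarith)
  have h2 : IntegrableOn (fun u : ℝ ↦ u ^ (β - 1) * bumpProfile m u) (Set.Ioo 0 2) := by
    refine Integrable.mono' h1 ?_ ?_
    · exact ((measurable_id.pow_const _).mul
        (continuous_bumpProfile m).measurable).aestronglyMeasurable
    · refine (ae_restrict_iff' measurableSet_Ioo).2 (.of_forall fun u hu ↦ ?_)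
      have hu0 : 0 < u := hu.1
      rw [Real.norm_of_nonneg (mul_nonneg (by positivity) (bumpProfile_nonneg m u))]
      calc _ ≤ u ^ (β - 1) * (u ^ 2) ^ m := by gcongr; exact bumpProfile_le m u
        _ = _ := by
          rw [← pow_mul, ← Real.rpow_natCast, ← Real.rpow_add hu0]
          push_cast
          ring_nf
  refine h2.of_forall_sdiff_eq_zero measurableSet_Ioi fun u hu ↦ ?_
  have h0 : 0 < u := hu.1
  have h3 : 2 ≤ u := by
    by_contra h
    exact hu.2 ⟨h0, not_le.1 h⟩
  rw [bumpProfile_eq_zero m (by rwa [abs_of_pos h0]), mul_zero]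

/-- Every power `ρ^{-β}` with `β > -2m` is a superposition of dilates of `bumpProfile m`. -/
theorem exists_integral_rpow_mul_bumpProfile (m : ℕ) {β : ℝ} (hβ : 0 < 2 * m + β) :
    ∃ c : ℝ, 0 < c ∧ ∀ ρ : ℝ, 0 < ρ →
      IntegrableOn (fun s : ℝ ↦ s ^ (β - 1) * bumpProfile m (s * ρ)) (Set.Ioi 0) ∧
      ∫ s in Set.Ioi (0 : ℝ), s ^ (β - 1) * bumpProfile m (s * ρ) = c * ρ ^ (-β) := by
  have hint := integrableOn_rpow_mul_bumpProfile m hβ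
  refine ⟨∫ u in Set.Ioi (0 : ℝ), u ^ (β - 1) * bumpProfile m u, ?_, fun ρ hρ ↦ ?_⟩
  · rw [setIntegral_pos_iff_support_of_nonneg_ae _ hint]
    · refine lt_of_lt_of_le ?_ (measure_mono (s := Set.Ioo (0 : ℝ) 1) fun u hu ↦ ?_)
      · simp
      · have hu0 : 0 < u := hu.1
        refine ⟨?_, hu.1⟩
        rw [Function.mem_support,
          bumpProfile_of_abs_le_one m (by rw [abs_of_pos hu0]; exact hu.2.le)]
        positivity
    · refine (ae_restrict_iff' measurableSet_Ioi).2 (.of_forall fun u hu ↦ ?_)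
      have hu0 : 0 < u := hu
      exact mul_nonneg (by positivity) (bumpProfile_nonneg m u)
  · have heq : Set.EqOn (fun s : ℝ ↦ s ^ (β - 1) * bumpProfile m (s * ρ))
        (fun s : ℝ ↦ ρ ^ (1 - β) * ((ρ * s) ^ (β - 1) * bumpProfile m (ρ * s))) (Set.Ioi 0) := by
      intro s hs
      have hs0 : 0 < s := hs
      simp only
      rw [Real.mul_rpow hρ.le hs0.le, mul_comm s ρ, ← mul_assoc, ← mul_assoc, ← Real.rpow_add hρ]
      simp
    constructor
    · rw [integrableOn_congr_fun heq measurableSet_Ioi]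
      refine Integrable.const_mul ?_ _
      rw [← IntegrableOn, integrableOn_Ioi_comp_mul_left_iff
        (fun u ↦ u ^ (β - 1) * bumpProfile m u) 0 hρ, mul_zero]
      exact hint
    · rw [setIntegral_congr_fun measurableSet_Ioi heq, integral_const_mul,
        integral_comp_mul_left_Ioi (fun u ↦ u ^ (β - 1) * bumpProfile m u) 0 hρ, mul_zero,
        smul_eq_mul, ← mul_assoc, ← Real.rpow_neg_one ρ, ← Real.rpow_add hρ, mul_comm]
      ring_nf

end Profile

section Fourier

open scoped SchwartzMap

variable {E : Type*} [NormedAddCommGroup E] [InnerProductSpace ℝ E] [FiniteDimensional ℝ E]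
  [MeasurableSpace E] [BorelSpace E]

theorem SchwartzMap.fourierInv_fourier_apply (f : 𝓢(E, ℂ)) (x : E) :
    𝓕⁻ (fun ξ ↦ 𝓕 (f : E → ℂ) ξ) x = f x := by
  change 𝓕⁻ (⇑(𝓕 f : 𝓢(E, ℂ))) x = _
  rw [← SchwartzMap.fourierInv_coe]
  simp

theorem exists_schwartz_bumpProfile (m : ℕ) :
    ∃ a : 𝓢(E, ℂ), ∀ ξ : E, 𝓕 (a : E → ℂ) ξ = (bumpProfile m ‖ξ‖ : ℂ) := by
  have h1 : ContDiff ℝ ∞ fun ξ : E ↦ (bumpProfile m ‖ξ‖ : ℂ) := by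
    unfold bumpProfile
    refine Complex.ofRealCLM.contDiff.comp ?_
    exact ((contDiff_norm_sq ℝ).pow m).mul
      ((ContDiffBump.contDiff _).comp (contDiff_norm_sq ℝ))
  have h2 : HasCompactSupport fun ξ : E ↦ (bumpProfile m ‖ξ‖ : ℂ) := by
    refine HasCompactSupport.intro (isCompact_closedBall (0 : E) 2) fun ξ hξ ↦ ?_
    rw [bumpProfile_eq_zero, Complex.ofReal_zero]
    rw [mem_closedBall_zero_iff, not_le] at hξ
    rw [abs_norm]
    exact hξ.le
  refine ⟨𝓕⁻ (h2.toSchwartzMap h1), fun ξ ↦ ?_⟩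
  change (𝓕 (𝓕⁻ (h2.toSchwartzMap h1)) : 𝓢(E, ℂ)) ξ = _
  simp

/-- The Fourier multiplier `ξ ↦ â(sξ)` acts by averaging the translates `x - s y` against `a`. -/
theorem fourierInv_fourier_smul_mul {a H : E → ℂ} (ha : Integrable a) (hH : Integrable H)
    (s : ℝ) (x : E) :
    𝓕⁻ (fun ξ ↦ 𝓕 a (s • ξ) * H ξ) x = ∫ y, a y * 𝓕⁻ H (x - s • y) := by
  have hchar : ∀ ξ y : E, Real.fourierChar (inner ℝ ξ x) •
      ((Real.fourierChar (-inner ℝ y (s • ξ)) • a y) * H ξ) =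
      a y * (Real.fourierChar (inner ℝ ξ (x - s • y)) • H ξ) := by
    intro ξ y
    rw [inner_sub_right, real_inner_smul_right, real_inner_smul_right, sub_eq_add_neg,
      AddChar.map_add_eq_mul, real_inner_comm y ξ]
    simp only [Circle.smul_def, smul_eq_mul, Circle.coe_mul]
    ring
  have hint : Integrable (Function.uncurry fun ξ y : E ↦
      a y * (Real.fourierChar (inner ℝ ξ (x - s • y)) • H ξ)) (volume.prod volume) := by
    have h := hH.mul_prod ha
    refine (h.bdd_mul (c := 1) (f := fun z : E × E ↦
      ((Real.fourierChar (inner ℝ z.1 (x - s • z.2)) : Circle) : ℂ)) ?_ ?_).congr ?_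
    · refine Continuous.aestronglyMeasurable ?_
      exact continuous_subtype_val.comp (Real.continuous_fourierChar.comp (by fun_prop))
    · exact .of_forall fun z ↦ (Circle.norm_coe _).le
    · refine .of_forall fun z ↦ ?_
      simp only [Function.uncurry, Circle.smul_def, smul_eq_mul]
      ring
  calc 𝓕⁻ (fun ξ ↦ 𝓕 a (s • ξ) * H ξ) x
      = ∫ ξ, ∫ y, a y * (Real.fourierChar (inner ℝ ξ (x - s • y)) • H ξ) := by
        rw [Real.fourierInv_eq]
        congr 1 with ξ
        rw [Real.fourier_eq, ← integral_mul_const, Circle.smul_def, ← integral_smul]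
        congr 1 with y
        rw [← hchar]
        rfl
    _ = ∫ y, ∫ ξ, a y * (Real.fourierChar (inner ℝ ξ (x - s • y)) • H ξ) :=
        integral_integral_swap hint
    _ = _ := by
        congr 1 with y
        rw [Real.fourierInv_eq, integral_const_mul]

theorem enorm_fourierInv_fourier_smul_mul_le {a H : E → ℂ} (ha : Integrable a)
    (hH : Integrable H) (s : ℝ) (x : E) :
    ‖𝓕⁻ (fun ξ ↦ 𝓕 a (s • ξ) * H ξ) x‖ₑ ≤ ∫⁻ y, ‖a y‖ₑ * ‖𝓕⁻ H (x - s • y)‖ₑ := by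
  rw [fourierInv_fourier_smul_mul ha hH]
  refine (enorm_integral_le_lintegral_enorm _).trans_eq ?_
  simp only [enorm_mul]

/-- Littlewood–Paley type reproduction of a homogeneous multiplier `|ξ|^{-β}`: its action is
controlled by the actions of the dilated bumps `bumpProfile m (s|ξ|)`, integrated over `s`. -/
theorem exists_enorm_fourierInv_le [Nontrivial E] (m : ℕ) {β : ℝ} (hβ : 0 < 2 * m + β) :
    ∃ C : ℝ≥0∞, C ≠ ⊤ ∧ ∀ H K : E → ℂ, AEStronglyMeasurable H volume → Integrable K →
      (∀ ξ, ξ ≠ 0 → K ξ = ((‖ξ‖ ^ (-β) : ℝ) : ℂ) * H ξ) → ∀ x : E,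
      ‖𝓕⁻ K x‖ₑ ≤ C * ∫⁻ s in Set.Ioi (0 : ℝ), ENNReal.ofReal (s ^ (β - 1)) *
        ‖𝓕⁻ (fun ξ ↦ (bumpProfile m ‖s • ξ‖ : ℂ) * H ξ) x‖ₑ := by
  obtain ⟨c, hc, h⟩ := exists_integral_rpow_mul_bumpProfile m hβ
  refine ⟨ENNReal.ofReal c⁻¹, ENNReal.ofReal_ne_top, fun H K hH hK hHK x ↦ ?_⟩
  have hne : ∀ᵐ ξ : E, ξ ≠ 0 := by simp [ae_iff, measure_singleton]
  let Φ : E → ℝ → ℂ := fun ξ s ↦ ((s ^ (β - 1) * bumpProfile m (s * ‖ξ‖) : ℝ) : ℂ) *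
    (Real.fourierChar (inner ℝ ξ x) • H ξ)
  have hΦ : ∀ ξ, ξ ≠ 0 → IntegrableOn (Φ ξ) (Set.Ioi 0) ∧
      ∫ s in Set.Ioi (0 : ℝ), Φ ξ s = c * (Real.fourierChar (inner ℝ ξ x) • K ξ) ∧
      ∫ s in Set.Ioi (0 : ℝ), ‖Φ ξ s‖ = c * ‖K ξ‖ := by
    intro ξ hξ
    obtain ⟨h1, h2⟩ := h ‖ξ‖ (norm_pos_iff.2 hξ)
    refine ⟨h1.ofReal.mul_const _, ?_, ?_⟩
    · simp only [Φ]
      rw [integral_mul_const, integral_complex_ofReal, h2, hHK ξ hξ]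
      simp only [Circle.smul_def, smul_eq_mul]
      push_cast
      ring
    · have : ∀ s ∈ Set.Ioi (0 : ℝ), ‖Φ ξ s‖ =
          s ^ (β - 1) * bumpProfile m (s * ‖ξ‖) * ‖H ξ‖ := by
        intro s hs
        have hs0 : 0 < s := hs
        simp only [Φ]
        rw [norm_mul, Circle.norm_smul, Complex.norm_real, Real.norm_of_nonneg
          (mul_nonneg (by positivity) (bumpProfile_nonneg _ _))]
      rw [setIntegral_congr_fun measurableSet_Ioi this, integral_mul_const, h2, hHK ξ hξ,
        norm_mul, Complex.norm_real, Real.norm_of_nonneg (by positivity), mul_assoc]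
  have hint : Integrable (Function.uncurry Φ) (volume.prod (volume.restrict (Set.Ioi 0))) := by
    rw [integrable_prod_iff]
    · refine ⟨hne.mono fun ξ hξ ↦ (hΦ ξ hξ).1, ?_⟩
      refine (hK.norm.const_mul c).congr ?_
      filter_upwards [hne] with ξ hξ
      exact (hΦ ξ hξ).2.2.symm
    · refine AEStronglyMeasurable.mul ?_ ?_
      · refine Measurable.aestronglyMeasurable ?_
        have := (continuous_bumpProfile m).measurable
        fun_prop
      · have h1 : AEStronglyMeasurable (fun ξ : E ↦ Real.fourierChar (inner ℝ ξ x) • H ξ)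
            volume := by
          simp only [Circle.smul_def, smul_eq_mul]
          refine AEStronglyMeasurable.mul (Continuous.aestronglyMeasurable ?_) hH
          exact continuous_subtype_val.comp (Real.continuous_fourierChar.comp (by fun_prop))
        exact h1.comp_fst
  have key : (c : ℂ) * 𝓕⁻ K x = ∫ s in Set.Ioi (0 : ℝ), ((s ^ (β - 1) : ℝ) : ℂ) *
      𝓕⁻ (fun ξ ↦ (bumpProfile m ‖s • ξ‖ : ℂ) * H ξ) x := by
    calc (c : ℂ) * 𝓕⁻ K x = ∫ ξ, ∫ s in Set.Ioi (0 : ℝ), Φ ξ s := by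
          rw [Real.fourierInv_eq, ← integral_const_mul]
          refine integral_congr_ae ?_
          filter_upwards [hne] with ξ hξ
          exact (hΦ ξ hξ).2.1.symm
      _ = ∫ s in Set.Ioi (0 : ℝ), ∫ ξ, Φ ξ s := integral_integral_swap hint
      _ = _ := by
          refine setIntegral_congr_fun measurableSet_Ioi fun s hs ↦ ?_
          have hs0 : 0 < s := hs
          simp only [Φ]
          rw [Real.fourierInv_eq, ← integral_const_mul]
          congr 1 with ξ
          rw [norm_smul, Real.norm_of_nonneg hs0.le]
          simp only [Circle.smul_def, smul_eq_mul]
          push_cast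
          ring
  have hK' : 𝓕⁻ K x = ((c⁻¹ : ℝ) : ℂ) * ((c : ℂ) * 𝓕⁻ K x) := by
    rw [← mul_assoc, ← Complex.ofReal_mul, inv_mul_cancel₀ hc.ne', Complex.ofReal_one, one_mul]
  rw [hK', key, enorm_mul, ← ofReal_norm ((c⁻¹ : ℝ) : ℂ), Complex.norm_real,
    Real.norm_of_nonneg (inv_nonneg.2 hc.le)]
  gcongr
  refine (enorm_integral_le_lintegral_enorm _).trans_eq ?_
  refine setLIntegral_congr_fun measurableSet_Ioi fun s hs ↦ ?_
  have hs0 : 0 < s := hs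
  rw [enorm_mul, ← ofReal_norm ((s ^ (β - 1) : ℝ) : ℂ), Complex.norm_real,
    Real.norm_of_nonneg (by positivity)]

end Fourier

/-! ### The fractional Laplacian of a Schwartz function -/

section Powers

theorem lintegral_Ioi_rpow_le {b ρ : ℝ} (hb : b < -1) (hρ : 0 < ρ) :
    ∫⁻ s in Set.Ioi ρ, ENNReal.ofReal (s ^ b) = ENNReal.ofReal (ρ ^ (b + 1) * (-(b + 1))⁻¹) := by
  rw [← ofReal_integral_eq_lintegral_ofReal (integrableOn_Ioi_rpow_of_lt hb hρ),
    integral_Ioi_rpow_of_lt hb hρ]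
  · congr 1
    rw [inv_neg, div_eq_mul_inv]; ring
  · refine (ae_restrict_iff' measurableSet_Ioi).2 (.of_forall fun u hu ↦ ?_)
    have hu0 : 0 < u := hρ.trans hu
    exact Real.rpow_nonneg hu0.le _

theorem lintegral_Ioc_rpow_le {b ρ : ℝ} (hb : -1 < b) (hρ : 0 < ρ) :
    ∫⁻ s in Set.Ioc 0 ρ, ENNReal.ofReal (s ^ b) = ENNReal.ofReal (ρ ^ (b + 1) * (b + 1)⁻¹) := by
  have h : IntervalIntegrable (fun x : ℝ ↦ x ^ b) volume 0 ρ :=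
    intervalIntegral.intervalIntegrable_rpow' hb
  rw [intervalIntegrable_iff_integrableOn_Ioc_of_le hρ.le] at h
  rw [← ofReal_integral_eq_lintegral_ofReal h, ← intervalIntegral.integral_of_le hρ.le,
    integral_rpow (Or.inl hb), Real.zero_rpow (by linarith), sub_zero, div_eq_mul_inv]
  refine (ae_restrict_iff' measurableSet_Ioc).2 (.of_forall fun u hu ↦ ?_)
  exact Real.rpow_nonneg hu.1.le _

end Powers

section FractionalPower

open scoped SchwartzMap

/-- Superposing the dilates of a rapidly decreasing function with weight `s^{α-d} ds/s` gives at
most a multiple of the Riesz kernel. -/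
theorem exists_lintegral_dilates_le {E : Type*} [NormedAddCommGroup E] [InnerProductSpace ℝ E]
    {d α : ℝ} (hd : (Module.finrank ℝ E : ℝ) = d) (hα : 0 < α) (hαd : α < d)
    (a : 𝓢(E, ℂ)) :
    ∃ C : ℝ≥0∞, C ≠ ⊤ ∧ ∀ w : E, w ≠ 0 →
      ∫⁻ s in Set.Ioi (0 : ℝ), ENNReal.ofReal (s ^ (α - 1 - d)) * ‖a (s⁻¹ • w)‖ₑ ≤
        C * ‖w‖ₑ ^ (-(d - α)) := by
  set N := Module.finrank ℝ E
  obtain ⟨B₀, hB₀, h₀⟩ := a.decay 0 0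
  obtain ⟨B, hB, hN⟩ := a.decay N 0
  simp only [pow_zero, one_mul, norm_iteratedFDeriv_zero] at h₀ hN
  refine ⟨ENNReal.ofReal (B * α⁻¹ + B₀ * (d - α)⁻¹), ENNReal.ofReal_ne_top, fun w hw ↦ ?_⟩
  set ρ := ‖w‖ with hρdef
  have hρ : 0 < ρ := norm_pos_iff.2 hw
  -- for `s ≤ ρ` use the decay `‖a z‖ ≤ B ‖z‖ ^ (-d)`, for `s > ρ` the boundedness of `a`
  have e1 : ∫⁻ s in Set.Ioc (0 : ℝ) ρ, ENNReal.ofReal (s ^ (α - 1 - d)) * ‖a (s⁻¹ • w)‖ₑ ≤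
      ENNReal.ofReal (B * ρ ^ (-d)) * ENNReal.ofReal (ρ ^ α * α⁻¹) := by
    calc _ ≤ ∫⁻ s in Set.Ioc (0 : ℝ) ρ, ENNReal.ofReal (B * ρ ^ (-d)) *
          ENNReal.ofReal (s ^ (α - 1)) := by
          refine setLIntegral_mono' measurableSet_Ioc fun s hs ↦ ?_
          have hs0 : 0 < s := hs.1
          rw [← ofReal_norm, ← ENNReal.ofReal_mul (by positivity),
            ← ENNReal.ofReal_mul (by positivity)]
          apply ENNReal.ofReal_le_ofReal
          have h1 := hN (s⁻¹ • w)
          rw [norm_smul, Real.norm_of_nonneg (by positivity), ← hρdef, mul_pow, inv_pow,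
            ← Real.rpow_natCast, ← Real.rpow_natCast ρ, hd] at h1
          have h2 : ‖a (s⁻¹ • w)‖ ≤ B * ρ ^ (-d) * s ^ d := by
            rw [Real.rpow_neg hρ.le, ← div_eq_mul_inv, div_mul_eq_mul_div,
              le_div_iff₀ (by positivity)]
            calc _ = ((s ^ d)⁻¹ * ρ ^ d * ‖a (s⁻¹ • w)‖) * s ^ d := by
                  have : s ^ d ≠ 0 := by positivity
                  field_simp
              _ ≤ _ := by gcongr
          calc _ ≤ s ^ (α - 1 - d) * (B * ρ ^ (-d) * s ^ d) := by gcongr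
            _ = B * ρ ^ (-d) * (s ^ (α - 1 - d) * s ^ d) := by ring
            _ = _ := by rw [← Real.rpow_add hs0, sub_add_cancel]
      _ = _ := by
          rw [lintegral_const_mul' _ _ ENNReal.ofReal_ne_top,
            lintegral_Ioc_rpow_le (by linarith) hρ, sub_add_cancel]
  have e2 : ∫⁻ s in Set.Ioi ρ, ENNReal.ofReal (s ^ (α - 1 - d)) * ‖a (s⁻¹ • w)‖ₑ ≤
      ENNReal.ofReal (ρ ^ (α - d) * (d - α)⁻¹) * ENNReal.ofReal B₀ := by
    calc _ ≤ ∫⁻ s in Set.Ioi ρ, ENNReal.ofReal (s ^ (α - 1 - d)) * ENNReal.ofReal B₀ := by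
          refine lintegral_mono fun s ↦ ?_
          rw [← ofReal_norm]
          gcongr
          exact h₀ _
      _ = _ := by
          rw [lintegral_mul_const' _ _ ENNReal.ofReal_ne_top,
            lintegral_Ioi_rpow_le (by linarith) hρ]
          ring_nf
  rw [← Set.Ioc_union_Ioi_eq_Ioi hρ.le]
  refine (lintegral_union_le _ _ _).trans ((add_le_add e1 e2).trans_eq ?_)
  have hd' : 0 < d - α := by linarith
  rw [← ofReal_norm w, ← hρdef, ENNReal.ofReal_rpow_of_pos hρ, ← ENNReal.ofReal_mul (by positivity),
    ← ENNReal.ofReal_mul (by positivity), ← ENNReal.ofReal_add (by positivity) (by positivity),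
    ← ENNReal.ofReal_mul (by positivity)]
  congr 1
  rw [show -(d - α) = α - d by ring, show B * ρ ^ (-d) * (ρ ^ α * α⁻¹) =
    B * (ρ ^ α * ρ ^ (-d)) * α⁻¹ by ring, ← Real.rpow_add hρ, ← sub_eq_add_neg]
  ring

variable {E : Type*} [NormedAddCommGroup E] [InnerProductSpace ℝ E] [FiniteDimensional ℝ E]
  [MeasurableSpace E] [BorelSpace E]

theorem lintegral_lintegral_mul_translate_eq {a g : E → ℂ} (ha : Continuous a)
    (hg : Continuous g) (s : ℝ) :
    ∫⁻ x, ∫⁻ y, ‖a y‖ₑ * ‖g (x - s • y)‖ₑ = (∫⁻ y, ‖a y‖ₑ) * ∫⁻ x, ‖g x‖ₑ := by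
  have ha' := ha.measurable
  have hg' := hg.measurable
  rw [lintegral_lintegral_swap (by unfold Function.uncurry; fun_prop),
    ← lintegral_mul_const _ (by fun_prop)]
  congr 1 with y
  rw [lintegral_const_mul _ (by fun_prop), lintegral_sub_right_eq_self (fun x ↦ ‖g x‖ₑ)]

theorem integrable_rpow_norm_mul_fourier {α : ℝ} (hα : 0 < α) (G : 𝓢(E, ℂ)) :
    Integrable fun ξ : E ↦ ((‖ξ‖ ^ α : ℝ) : ℂ) * 𝓕 (G : E → ℂ) ξ := by
  obtain ⟨k, hk⟩ := exists_nat_ge α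
  have h0 : Integrable fun ξ : E ↦ ‖(𝓕 G : 𝓢(E, ℂ)) ξ‖ := (𝓕 G : 𝓢(E, ℂ)).integrable.norm
  have h1 : Integrable fun ξ : E ↦ ‖ξ‖ ^ k * ‖(𝓕 G : 𝓢(E, ℂ)) ξ‖ :=
    (𝓕 G : 𝓢(E, ℂ)).integrable_pow_mul volume k
  refine (h0.add h1).mono' ?_ (.of_forall fun ξ ↦ ?_)
  · refine Continuous.aestronglyMeasurable ?_
    refine (Complex.continuous_ofReal.comp (continuous_norm.rpow_const fun _ ↦ Or.inr hα.le)).mul ?_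
    exact (𝓕 G : 𝓢(E, ℂ)).continuous
  · rw [norm_mul, Complex.norm_real, Real.norm_of_nonneg (by positivity)]
    change _ ≤ ‖(𝓕 G : 𝓢(E, ℂ)) ξ‖ + ‖ξ‖ ^ k * ‖(𝓕 G : 𝓢(E, ℂ)) ξ‖
    rw [← one_add_mul]
    refine mul_le_mul ?_ le_rfl (norm_nonneg _) (by positivity)
    rcases le_total ‖ξ‖ 1 with h | h
    · have := Real.rpow_le_one (norm_nonneg ξ) h hα.le
      have : 0 ≤ ‖ξ‖ ^ k := by positivity
      linarith
    · have := Real.rpow_le_rpow_of_exponent_le h hk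
      rw [Real.rpow_natCast] at this
      linarith

theorem continuous_fourierInv_of_integrable {f : E → ℂ} (hf : Integrable f) :
    Continuous (𝓕⁻ f) := by
  have : Continuous (𝓕 f) :=
    VectorFourier.fourierIntegral_continuous Real.continuous_fourierChar
      (by exact continuous_inner) hf
  have h : 𝓕⁻ f = fun x ↦ 𝓕 f (-x) := by
    ext x; exact Real.fourierInv_eq_fourier_neg f x
  rw [h]
  exact this.comp continuous_neg

/-- The multiplier `|ξ|^α` maps Schwartz functions into `L¹`. In the superposition of the dilates
`bumpProfile m (s|ξ|)` with weight `s^{-α-1} ds`, large `s` converge outright; for small `s` the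
factor `|ξ|^{2m}` of the bump is moved to the Schwartz function, which gains `s^{2m}`. -/
theorem lintegral_enorm_fourierInv_rpow_mul_lt_top [Nontrivial E] {α : ℝ} (hα : 0 < α)
    (G : 𝓢(E, ℂ)) :
    ∫⁻ x, ‖𝓕⁻ (fun ξ : E ↦ ((‖ξ‖ ^ α : ℝ) : ℂ) * 𝓕 (G : E → ℂ) ξ) x‖ₑ < ⊤ := by
  obtain ⟨m, hm⟩ := exists_nat_gt α
  have hβ : 0 < 2 * (m : ℝ) + -α := by linarith
  obtain ⟨C, hC, h⟩ := exists_enorm_fourierInv_le (E := E) m hβ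
  obtain ⟨a, ha⟩ := exists_schwartz_bumpProfile (E := E) m
  obtain ⟨a₀, ha₀⟩ := exists_schwartz_bumpProfile (E := E) 0
  have htg : Function.HasTemperateGrowth fun ξ : E ↦ (((‖ξ‖ ^ 2) ^ m : ℝ) : ℂ) :=
    Function.Complex.hasTemperateGrowth_ofReal.comp ((Function.hasTemperateGrowth_norm_sq E).pow m)
  set W : 𝓢(E, ℂ) := SchwartzMap.smulLeftCLM ℂ (fun ξ : E ↦ (((‖ξ‖ ^ 2) ^ m : ℝ) : ℂ)) (𝓕 G)
  have hW : ∀ ξ, W ξ = (((‖ξ‖ ^ 2) ^ m : ℝ) : ℂ) * 𝓕 (G : E → ℂ) ξ := fun ξ ↦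
    SchwartzMap.smulLeftCLM_apply_apply htg _ _
  set G' : 𝓢(E, ℂ) := 𝓕⁻ W
  have hG' : ∀ x, 𝓕⁻ (W : E → ℂ) x = G' x := fun x ↦ by
    rw [← SchwartzMap.fourierInv_coe]
  have hG : ∀ x, 𝓕⁻ (fun ξ ↦ 𝓕 (G : E → ℂ) ξ) x = G x := G.fourierInv_fourier_apply
  have hFG : Integrable fun ξ ↦ 𝓕 (G : E → ℂ) ξ := (𝓕 G : 𝓢(E, ℂ)).integrable
  have hlarge : ∀ s : ℝ, ∀ x, ‖𝓕⁻ (fun ξ ↦ (bumpProfile m ‖s • ξ‖ : ℂ) * 𝓕 (G : E → ℂ) ξ) x‖ₑ ≤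
      ∫⁻ y, ‖a y‖ₑ * ‖G (x - s • y)‖ₑ := by
    intro s x
    simp only [← ha, ← hG]
    exact enorm_fourierInv_fourier_smul_mul_le a.integrable hFG s x
  have hsmall : ∀ s : ℝ, 0 < s → ∀ x,
      ‖𝓕⁻ (fun ξ ↦ (bumpProfile m ‖s • ξ‖ : ℂ) * 𝓕 (G : E → ℂ) ξ) x‖ₑ ≤
      ENNReal.ofReal (s ^ (2 * (m : ℝ))) * ∫⁻ y, ‖a₀ y‖ₑ * ‖G' (x - s • y)‖ₑ := by
    intro s hs x
    have e1 : (fun ξ ↦ (bumpProfile m ‖s • ξ‖ : ℂ) * 𝓕 (G : E → ℂ) ξ) =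
        ((s ^ (2 * (m : ℝ)) : ℝ) : ℂ) • fun ξ ↦ 𝓕 (a₀ : E → ℂ) (s • ξ) * W ξ := by
      ext ξ
      rw [Pi.smul_apply, ha₀, hW, bumpProfile_eq_mul, norm_smul, Real.norm_of_nonneg hs.le,
        mul_pow, mul_pow, ← pow_mul s, Real.rpow_mul hs.le, Real.rpow_natCast]
      rw [Real.rpow_ofNat, ← pow_mul]
      simp only [smul_eq_mul]
      push_cast
      ring
    have e2 : 𝓕⁻ (((s ^ (2 * (m : ℝ)) : ℝ) : ℂ) • fun ξ ↦ 𝓕 (a₀ : E → ℂ) (s • ξ) * W ξ) x =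
        ((s ^ (2 * (m : ℝ)) : ℝ) : ℂ) * 𝓕⁻ (fun ξ ↦ 𝓕 (a₀ : E → ℂ) (s • ξ) * W ξ) x := by
      rw [Real.fourierInv_eq, Real.fourierInv_eq, ← integral_const_mul]
      congr 1 with ξ
      simp only [Pi.smul_apply, Circle.smul_def, smul_eq_mul]
      ring
    rw [e1, e2, enorm_mul, ← ofReal_norm ((s ^ (2 * (m : ℝ)) : ℝ) : ℂ), Complex.norm_real,
      Real.norm_of_nonneg (by positivity)]
    gcongr
    simp only [← hG']
    exact enorm_fourierInv_fourier_smul_mul_le a₀.integrable W.integrable s x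
  have hfin : ∀ f : 𝓢(E, ℂ), ∫⁻ y, ‖f y‖ₑ ≠ ⊤ := fun f ↦ f.integrable.hasFiniteIntegral.ne
  have hmG : ∀ (b : 𝓢(E, ℂ)) (g : 𝓢(E, ℂ)), Measurable fun z : (E × ℝ) × E ↦
      ‖b z.2‖ₑ * ‖g (z.1.1 - z.1.2 • z.2)‖ₑ := by
    intro b g
    have hb := b.continuous.measurable
    have hg := g.continuous.measurable
    fun_prop
  have hmS : ∀ (b : 𝓢(E, ℂ)) (g : 𝓢(E, ℂ)), Measurable fun z : E × ℝ ↦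
      ∫⁻ y, ‖b y‖ₑ * ‖g (z.1 - z.2 • y)‖ₑ := fun b g ↦ (hmG b g).lintegral_prod_right'
  have hr1 : Measurable fun s : ℝ ↦ ENNReal.ofReal (s ^ (2 * (m : ℝ) - α - 1)) := by fun_prop
  have hr2 : Measurable fun s : ℝ ↦ ENNReal.ofReal (s ^ (-α - 1)) := by fun_prop
  have hpt : ∀ x, ‖𝓕⁻ (fun ξ : E ↦ ((‖ξ‖ ^ α : ℝ) : ℂ) * 𝓕 (G : E → ℂ) ξ) x‖ₑ ≤
      C * ((∫⁻ s in Set.Ioc (0 : ℝ) 1, ENNReal.ofReal (s ^ (2 * (m : ℝ) - α - 1)) *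
          ∫⁻ y, ‖a₀ y‖ₑ * ‖G' (x - s • y)‖ₑ) +
        ∫⁻ s in Set.Ioi (1 : ℝ), ENNReal.ofReal (s ^ (-α - 1)) *
          ∫⁻ y, ‖a y‖ₑ * ‖G (x - s • y)‖ₑ) := by
    intro x
    refine (h (fun ξ ↦ 𝓕 (G : E → ℂ) ξ) _ hFG.1 (integrable_rpow_norm_mul_fourier hα G)
      (fun ξ _ ↦ by rw [neg_neg]) x).trans ?_
    rw [← Set.Ioc_union_Ioi_eq_Ioi (zero_le_one' ℝ)]
    gcongr
    refine (lintegral_union_le _ _ _).trans (add_le_add ?_ ?_)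
    · refine setLIntegral_mono' measurableSet_Ioc fun s hs ↦ ?_
      calc _ ≤ ENNReal.ofReal (s ^ (-α - 1)) * (ENNReal.ofReal (s ^ (2 * (m : ℝ))) *
            ∫⁻ y, ‖a₀ y‖ₑ * ‖G' (x - s • y)‖ₑ) := by
            gcongr
            exact hsmall s hs.1 x
        _ = _ := by
            rw [← mul_assoc, ← ENNReal.ofReal_mul (Real.rpow_nonneg hs.1.le _),
              ← Real.rpow_add hs.1]
            ring_nf
    · refine lintegral_mono fun s ↦ ?_
      gcongr
      exact hlarge s x
  refine (lintegral_mono hpt).trans_lt ?_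
  rw [lintegral_const_mul' _ _ hC]
  refine ENNReal.mul_lt_top hC.lt_top ?_
  have hm1 : Measurable fun z : E × ℝ ↦ ENNReal.ofReal (z.2 ^ (2 * (m : ℝ) - α - 1)) *
      ∫⁻ y, ‖a₀ y‖ₑ * ‖G' (z.1 - z.2 • y)‖ₑ := (hr1.comp measurable_snd).mul (hmS a₀ G')
  have hm2 : Measurable fun z : E × ℝ ↦ ENNReal.ofReal (z.2 ^ (-α - 1)) *
      ∫⁻ y, ‖a y‖ₑ * ‖G (z.1 - z.2 • y)‖ₑ := (hr2.comp measurable_snd).mul (hmS a G)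
  rw [lintegral_add_left hm1.lintegral_prod_right']
  refine ENNReal.add_lt_top.2 ⟨?_, ?_⟩
  · rw [lintegral_lintegral_swap (hm1.aemeasurable)]
    have : ∀ s : ℝ, ∫⁻ x, ENNReal.ofReal (s ^ (2 * (m : ℝ) - α - 1)) *
        ∫⁻ y, ‖a₀ y‖ₑ * ‖G' (x - s • y)‖ₑ =
        ENNReal.ofReal (s ^ (2 * (m : ℝ) - α - 1)) * ((∫⁻ y, ‖a₀ y‖ₑ) * ∫⁻ x, ‖G' x‖ₑ) := by
      intro s
      rw [lintegral_const_mul' _ _ ENNReal.ofReal_ne_top,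
        lintegral_lintegral_mul_translate_eq a₀.continuous G'.continuous]
    simp only [this]
    rw [lintegral_mul_const _ hr1, lintegral_Ioc_rpow_le (by linarith) one_pos]
    exact ENNReal.mul_lt_top ENNReal.ofReal_lt_top
      (ENNReal.mul_lt_top (hfin _).lt_top (hfin _).lt_top)
  · rw [lintegral_lintegral_swap (hm2.aemeasurable)]
    have : ∀ s : ℝ, ∫⁻ x, ENNReal.ofReal (s ^ (-α - 1)) *
        ∫⁻ y, ‖a y‖ₑ * ‖G (x - s • y)‖ₑ =
        ENNReal.ofReal (s ^ (-α - 1)) * ((∫⁻ y, ‖a y‖ₑ) * ∫⁻ x, ‖G x‖ₑ) := by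
      intro s
      rw [lintegral_const_mul' _ _ ENNReal.ofReal_ne_top,
        lintegral_lintegral_mul_translate_eq a.continuous G.continuous]
    simp only [this]
    rw [lintegral_mul_const _ hr2, lintegral_Ioi_rpow_le (by linarith) one_pos]
    exact ENNReal.mul_lt_top ENNReal.ofReal_lt_top
      (ENNReal.mul_lt_top (hfin _).lt_top (hfin _).lt_top)

/-- A Schwartz function is dominated by the Riesz potential of order `α` of its fractional
derivative of order `α`. -/
theorem exists_enorm_le_riesz_potential [Nontrivial E] {d α : ℝ}
    (hd : (Module.finrank ℝ E : ℝ) = d) (hα : 0 < α) (hαd : α < d) :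
    ∃ C : ℝ≥0∞, C ≠ ⊤ ∧ ∀ (G : 𝓢(E, ℂ)) (f : E → ℂ),
      f = 𝓕⁻ (fun ξ : E ↦ ((‖ξ‖ ^ α : ℝ) : ℂ) * 𝓕 (G : E → ℂ) ξ) →
      ∀ x, ‖G x‖ₑ ≤ C * ∫⁻ y, ‖x - y‖ₑ ^ (-(d - α)) * ‖f y‖ₑ := by
  obtain ⟨C₁, hC₁, h₁⟩ := exists_enorm_fourierInv_le (E := E) 0 (β := α) (by simpa using hα)
  obtain ⟨a, ha⟩ := exists_schwartz_bumpProfile (E := E) 0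
  obtain ⟨C₂, hC₂, h₂⟩ := exists_lintegral_dilates_le hd hα hαd a
  refine ⟨C₁ * C₂, ENNReal.mul_ne_top hC₁ hC₂, fun G f hf x ↦ ?_⟩
  have hh := integrable_rpow_norm_mul_fourier hα G
  have hfc : Continuous f := by rw [hf]; exact continuous_fourierInv_of_integrable hh
  have hfm := hfc.measurable
  have ham := a.continuous.measurable
  have hFG : Integrable fun ξ ↦ 𝓕 (G : E → ℂ) ξ := (𝓕 G : 𝓢(E, ℂ)).integrable
  have hscale : ∀ s : ℝ, 0 < s → ∫⁻ y, ‖a y‖ₑ * ‖f (x - s • y)‖ₑ =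
      ENNReal.ofReal (s ^ (-d)) * ∫⁻ y, ‖a (s⁻¹ • (x - y))‖ₑ * ‖f y‖ₑ := by
    intro s hs
    rw [← lintegral_sub_left_eq_self (fun y ↦ ‖a (s⁻¹ • (x - y))‖ₑ * ‖f y‖ₑ) x]
    simp only [sub_sub_cancel]
    have hmap := Measure.map_addHaar_smul (volume : Measure E) hs.ne'
    calc _ = ∫⁻ y, (fun w ↦ ‖a (s⁻¹ • w)‖ₑ * ‖f (x - w)‖ₑ) (s • y) := by
          congr 1 with y
          simp only [inv_smul_smul₀ hs.ne']
      _ = ∫⁻ w, ‖a (s⁻¹ • w)‖ₑ * ‖f (x - w)‖ₑ ∂(Measure.map (fun y ↦ s • y) volume) := by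
          rw [lintegral_map (by fun_prop) (by fun_prop)]
      _ = _ := by
          rw [hmap, lintegral_smul_measure, abs_of_pos (by positivity), smul_eq_mul,
            ← Real.rpow_natCast, hd, Real.rpow_neg hs.le]
  calc ‖G x‖ₑ = ‖𝓕⁻ (fun ξ ↦ 𝓕 (G : E → ℂ) ξ) x‖ₑ := by rw [G.fourierInv_fourier_apply]
    _ ≤ C₁ * ∫⁻ s in Set.Ioi (0 : ℝ), ENNReal.ofReal (s ^ (α - 1)) *
          ‖𝓕⁻ (fun ξ ↦ (bumpProfile 0 ‖s • ξ‖ : ℂ) *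
            (((‖ξ‖ ^ α : ℝ) : ℂ) * 𝓕 (G : E → ℂ) ξ)) x‖ₑ := by
        refine h₁ _ _ hh.1 hFG (fun ξ hξ ↦ ?_) x
        rw [← mul_assoc, ← Complex.ofReal_mul, ← Real.rpow_add (norm_pos_iff.2 hξ)]
        simp
    _ ≤ C₁ * ∫⁻ s in Set.Ioi (0 : ℝ), ∫⁻ y, ENNReal.ofReal (s ^ (α - 1 - d)) *
          ‖a (s⁻¹ • (x - y))‖ₑ * ‖f y‖ₑ := by
        gcongr C₁ * ?_
        refine setLIntegral_mono' measurableSet_Ioi fun s hs ↦ ?_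
        have hs0 : 0 < s := hs
        simp only [mul_assoc]
        rw [lintegral_const_mul _ (by fun_prop), sub_eq_add_neg (α - 1), Real.rpow_add hs0,
          ENNReal.ofReal_mul (by positivity), mul_assoc, ← hscale s hs0]
        gcongr
        simp only [← ha]
        refine (enorm_fourierInv_fourier_smul_mul_le a.integrable hh s x).trans_eq ?_
        rw [hf]
    _ = C₁ * ∫⁻ y, ∫⁻ s in Set.Ioi (0 : ℝ), ENNReal.ofReal (s ^ (α - 1 - d)) *
          ‖a (s⁻¹ • (x - y))‖ₑ * ‖f y‖ₑ := by
        rw [lintegral_lintegral_swap]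
        unfold Function.uncurry
        fun_prop
    _ ≤ C₁ * ∫⁻ y, C₂ * (‖x - y‖ₑ ^ (-(d - α)) * ‖f y‖ₑ) := by
        gcongr C₁ * ?_
        have hne : ∀ᵐ y : E, y ≠ x := by simp [ae_iff, measure_singleton]
        refine lintegral_mono_ae (hne.mono fun y hy ↦ ?_)
        rw [lintegral_mul_const _ (by fun_prop), ← mul_assoc]
        gcongr
        exact h₂ _ (sub_ne_zero.2 hy.symm)
    _ = _ := by
        rw [lintegral_const_mul' _ _ hC₂, mul_assoc]

end FractionalPower

/-! ### Morrey norms -/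

section Morrey

variable {n : ℕ}

/-- The Morrey norm bound without roots: `∫_B |f|^p ≤ T^p |B|^{1 - p/q}` for every ball. -/
theorem morreyNorm_le_iff [NeZero n] {p q : ℝ} (hp : 0 < p) {f : EuclideanSpace ℝ (Fin n) → ℂ}
    {T : ℝ≥0∞} :
    morreyNorm p q f ≤ T ↔ ∀ (a : EuclideanSpace ℝ (Fin n)) (r : ℝ), 0 < r →
      ∫⁻ y in Metric.ball a r, ‖f y‖ₑ ^ p ≤ T ^ p * volume (Metric.ball a r) ^ (1 - p / q) := by
  simp only [morreyNorm, iSup_le_iff]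
  refine forall_congr' fun a ↦ forall_congr' fun r ↦ forall_congr' fun hr ↦ ?_
  have hB0 : volume (Metric.ball a r) ≠ 0 := (Metric.measure_ball_pos _ _ hr).ne'
  have hBt : volume (Metric.ball a r) ≠ ⊤ := measure_ball_lt_top.ne
  generalize ∫⁻ y in Metric.ball a r, ‖f y‖ₑ ^ p = I
  generalize volume (Metric.ball a r) = B at *
  have e1 : (1 - p / q) = -((1 / q - 1 / p) * p) := by field_simp; ring
  have hb0 : B ^ ((1 / q - 1 / p) * p) ≠ 0 := by simp [ENNReal.rpow_eq_zero_iff, hB0, hBt]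
  have hbt : B ^ ((1 / q - 1 / p) * p) ≠ ⊤ := rpow_ne_top_of_ne hB0 hBt _
  rw [← ENNReal.rpow_le_rpow_iff hp, ENNReal.mul_rpow_of_nonneg _ _ hp.le, ← ENNReal.rpow_mul,
    ← ENNReal.rpow_mul, one_div_mul_cancel hp.ne', ENNReal.rpow_one, e1, ENNReal.rpow_neg,
    ← div_eq_mul_inv, ENNReal.le_div_iff_mul_le (Or.inl hb0) (Or.inl hbt), mul_comm]

theorem volume_ball_rpow_eq [NeZero n] {p q : ℝ} (a : EuclideanSpace ℝ (Fin n)) {r : ℝ}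
    (hr : 0 < r) :
    volume (Metric.ball a r) ^ (1 - p / q) =
      volume (Metric.ball (0 : EuclideanSpace ℝ (Fin n)) 1) ^ (1 - p / q) *
        ENNReal.ofReal r ^ ((n : ℝ) - n / q * p) := by
  rw [volume_ball_eq_rpow (d := n) (by simp) a hr, ENNReal.mul_rpow_of_ne_top
    volume_unit_ball_ne_top (ofReal_rpow_ne_top hr _), ← ENNReal.rpow_mul]
  ring_nf

/-- `L¹ ∩ L^∞ ⊆ L^q ⊆ M^p_q`, the second inclusion by Hölder's inequality on each ball. -/
theorem morreyNorm_lt_top [NeZero n] {p q : ℝ} (hp : 1 ≤ p) (hpq : p ≤ q)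
    {f : EuclideanSpace ℝ (Fin n) → ℂ} (hf : Continuous f) (hf1 : ∫⁻ x, ‖f x‖ₑ < ⊤) {S : ℝ≥0∞}
    (hS : S ≠ ⊤) (hfS : ∀ x, ‖f x‖ₑ ≤ S) : morreyNorm p q f < ⊤ := by
  have hp0 : 0 < p := by linarith
  have hq0 : 0 < q := by linarith
  have hfm : Measurable f := hf.measurable
  have hI : ∫⁻ x, ‖f x‖ₑ ^ q < ⊤ := by
    calc _ ≤ ∫⁻ x, S ^ (q - 1) * ‖f x‖ₑ := by
          refine lintegral_mono fun x ↦ ?_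
          calc ‖f x‖ₑ ^ q = ‖f x‖ₑ ^ (q - 1) * ‖f x‖ₑ := by
                conv_lhs => rw [← sub_add_cancel q 1]
                rw [ENNReal.rpow_add_of_nonneg _ _ (by linarith) zero_le_one, ENNReal.rpow_one]
            _ ≤ _ := by
                gcongr
                · linarith
                · exact hfS x
      _ < ⊤ := by
          rw [lintegral_const_mul _ (by fun_prop)]
          exact ENNReal.mul_lt_top (ENNReal.rpow_lt_top_of_nonneg (by linarith) hS) hf1
  refine lt_of_le_of_lt ((morreyNorm_le_iff hp0 (T := (∫⁻ x, ‖f x‖ₑ ^ q) ^ (1 / q))).2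
    fun a r hr ↦ ?_) (ENNReal.rpow_lt_top_of_nonneg (by positivity) hI.ne)
  have h := ENNReal.lintegral_mul_norm_pow_le (μ := volume.restrict (Metric.ball a r))
    (f := fun x ↦ ‖f x‖ₑ ^ q) (g := fun _ ↦ 1) (by fun_prop) (by fun_prop)
    (p := p / q) (q := 1 - p / q) (by positivity) (by rw [sub_nonneg, div_le_one hq0]; exact hpq)
    (by ring)
  simp only [ENNReal.one_rpow, mul_one, lintegral_const, one_mul,
    Measure.restrict_apply_univ] at h
  calc _ = ∫⁻ y in Metric.ball a r, (‖f y‖ₑ ^ q) ^ (p / q) := by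
        congr 1 with y
        rw [← ENNReal.rpow_mul, mul_div_cancel₀ _ hq0.ne']
    _ ≤ _ := h
    _ ≤ _ := by
        rw [← ENNReal.rpow_mul, one_div_mul_eq_div]
        gcongr
        exact Measure.restrict_le_self

theorem enorm_rpow_norm_mul_le {E : Type*} [NormedAddCommGroup E] {α : ℝ} (hα : 0 < α) (x : E)
    (z : ℂ) : ‖((‖x‖ ^ (-α) : ℝ) : ℂ) * z‖ₑ ≤ ‖x‖ₑ ^ (-α) * ‖z‖ₑ := by
  rw [enorm_mul]
  gcongr
  rw [← ofReal_norm, Complex.norm_real, Real.norm_of_nonneg (by positivity)]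
  rcases eq_or_ne x 0 with rfl | hx
  · -- the real power `0 ^ (-α)` is `0`, whereas the extended one is `⊤`
    rw [norm_zero, Real.zero_rpow (by linarith), ENNReal.ofReal_zero]
    exact zero_le
  · rw [← ofReal_norm x, ENNReal.ofReal_rpow_of_pos (norm_pos_iff.2 hx)]

open scoped SchwartzMap in
/-- The constant `(2π)^α` coming from the normalization of `𝓕` is absorbed into the function. -/
theorem fracLaplacian_eq {α : ℝ} (g : 𝓢(EuclideanSpace ℝ (Fin n), ℂ)) :
    fracLaplacian α g = 𝓕⁻ (fun ξ : EuclideanSpace ℝ (Fin n) ↦ ((‖ξ‖ ^ α : ℝ) : ℂ) *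
      𝓕 ((((2 * Real.pi) ^ α : ℝ) : ℂ) • g : 𝓢(EuclideanSpace ℝ (Fin n), ℂ)) ξ) := by
  unfold fracLaplacian
  congr 1
  ext ξ
  have h : 𝓕 ((((2 * Real.pi) ^ α : ℝ) : ℂ) • g : 𝓢(EuclideanSpace ℝ (Fin n), ℂ)) ξ =
      (((2 * Real.pi) ^ α : ℝ) : ℂ) * 𝓕 (g : EuclideanSpace ℝ (Fin n) → ℂ) ξ := by
    rw [FourierTransform.fourier_smul]
    rfl
  rw [h, Real.mul_rpow (by positivity) (norm_nonneg ξ)]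
  push_cast
  ring

end Morrey

theorem proposition3p1 (n : ℕ) (p q α : ℝ) (hp : 1 < p) (hpq : p ≤ q)
    (hα : 0 < α) (hαn : α < (n : ℝ) / q) :
    ∃ C : ℝ≥0, ∀ g : EuclideanSpace ℝ (Fin n) → ℂ, ContDiff ℝ ∞ g → HasCompactSupport g →
      MemMorrey p q (fracLaplacian α g) ∧
      MemMorrey p q (fun x => ((‖x‖ ^ (-α) : ℝ) : ℂ) * g x) ∧
      morreyNorm p q (fun x => ((‖x‖ ^ (-α) : ℝ) : ℂ) * g x) ≤
        C * morreyNorm p q (fracLaplacian α g) := by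
  have hp0 : 0 < p := by linarith
  have hq0 : 0 < q := by linarith
  have hn0 : n ≠ 0 := by
    rintro rfl
    rw [Nat.cast_zero, zero_div] at hαn
    linarith
  have : NeZero n := ⟨hn0⟩
  have hsp : (n : ℝ) / q * p ≤ n := by
    rw [div_mul_eq_mul_div, div_le_iff₀ hq0]
    gcongr
  have hαd : α < n := by
    refine hαn.trans_le ?_
    rw [div_le_iff₀ hq0]
    exact le_mul_of_one_le_right (by positivity) (by linarith)
  obtain ⟨C₁, hC₁, h₁⟩ := exists_enorm_le_riesz_potential (E := EuclideanSpace ℝ (Fin n))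
    (d := n) (by simp) hα hαd
  obtain ⟨C₂, hC₂, h₂⟩ := exists_morrey_weighted_riesz_le (E := EuclideanSpace ℝ (Fin n))
    (d := n) (by simp) hα hαn hp hsp
  have hC : C₁ * C₂ ^ (1 / p) ≠ ⊤ :=
    ENNReal.mul_ne_top hC₁ (ENNReal.rpow_ne_top_of_nonneg (by positivity) hC₂)
  refine ⟨(C₁ * C₂ ^ (1 / p)).toNNReal, fun g hg hgc ↦ ?_⟩
  rw [ENNReal.coe_toNNReal hC]
  set f := fracLaplacian α g with hf
  set G := ((((2 * Real.pi) ^ α : ℝ) : ℂ) • hgc.toSchwartzMap hg) with hG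
  have hfG : f = 𝓕⁻ (fun ξ : EuclideanSpace ℝ (Fin n) ↦ ((‖ξ‖ ^ α : ℝ) : ℂ) *
      𝓕 (G : EuclideanSpace ℝ (Fin n) → ℂ) ξ) := fracLaplacian_eq (hgc.toSchwartzMap hg)
  have hh := integrable_rpow_norm_mul_fourier hα G
  have hfc : Continuous f := hfG ▸ continuous_fourierInv_of_integrable hh
  have hf1 : ∫⁻ x, ‖f x‖ₑ < ⊤ := hfG ▸ lintegral_enorm_fourierInv_rpow_mul_lt_top hα G
  have hfmem : MemMorrey p q f := by
    refine ⟨hfc.aestronglyMeasurable, morreyNorm_lt_top hp.le hpq hfc hf1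
      hh.hasFiniteIntegral.ne fun x ↦ ?_⟩
    rw [hfG, Real.fourierInv_eq]
    refine (enorm_integral_le_lintegral_enorm _).trans_eq ?_
    congr 1 with ξ
    rw [← ofReal_norm, Circle.norm_smul, ofReal_norm]
  have hgG : ∀ x, ‖g x‖ₑ ≤ ‖G x‖ₑ := by
    intro x
    have : G x = (((2 * Real.pi) ^ α : ℝ) : ℂ) * g x := rfl
    rw [this, enorm_mul]
    refine le_mul_of_one_le_left' ?_
    rw [← ofReal_norm, Complex.norm_real, ENNReal.one_le_ofReal,
      Real.norm_of_nonneg (by positivity)]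
    exact Real.one_le_rpow (by linarith [Real.pi_gt_three]) hα.le
  have hle : morreyNorm p q (fun x ↦ ((‖x‖ ^ (-α) : ℝ) : ℂ) * g x) ≤
      C₁ * C₂ ^ (1 / p) * morreyNorm p q f := by
    set N := morreyNorm p q f
    set v := volume (Metric.ball (0 : EuclideanSpace ℝ (Fin n)) 1)
    refine (morreyNorm_le_iff hp0).2 fun a r hr ↦ ?_
    have hM := h₂ (fun y ↦ ‖f y‖ₑ) (by have := hfc.measurable; fun_prop)
      (N ^ p * v ^ (1 - p / q)) (fun a r hr ↦ by
        have := (morreyNorm_le_iff hp0).1 (le_refl N) a r hr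
        rwa [volume_ball_rpow_eq a hr, ← mul_assoc] at this) a r hr
    calc _ ≤ ∫⁻ x in Metric.ball a r, C₁ ^ p *
          (‖x‖ₑ ^ (-α) * ∫⁻ y, ‖x - y‖ₑ ^ (-((n : ℝ) - α)) * ‖f y‖ₑ) ^ p := by
          refine lintegral_mono fun x ↦ ?_
          rw [← ENNReal.mul_rpow_of_nonneg _ _ hp0.le]
          gcongr
          refine (enorm_rpow_norm_mul_le hα x (g x)).trans ?_
          rw [mul_left_comm]
          gcongr
          exact (hgG x).trans (h₁ G f hfG x)
      _ ≤ C₁ ^ p * (C₂ * (N ^ p * v ^ (1 - p / q)) *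
            ENNReal.ofReal r ^ ((n : ℝ) - n / q * p)) := by
          rw [lintegral_const_mul' _ _ (ENNReal.rpow_ne_top_of_nonneg hp0.le hC₁)]
          gcongr
      _ = _ := by
          rw [volume_ball_rpow_eq a hr, ENNReal.mul_rpow_of_nonneg _ _ hp0.le,
            ENNReal.mul_rpow_of_nonneg _ _ hp0.le, ← ENNReal.rpow_mul C₂,
            one_div_mul_cancel hp0.ne', ENNReal.rpow_one]
          ring
  refine ⟨hfmem, ⟨?_, hle.trans_lt (ENNReal.mul_lt_top hC.lt_top hfmem.2)⟩, hle⟩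
  have := hg.continuous.measurable
  exact Measurable.aestronglyMeasurable (by fun_prop)
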